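/- Let $X$ be a smooth, projective (or, more generally, smooth and complete), split toric variety over $\mathbf{Q}$ with open torus $T$ and fan $\Sigma$. For each ray $\rho\in\Sigma(1)$ let $D_\rho$ be the corresponding $T$-invariant prime divisor and $[D_\rho]\in\operatorname{Pic}(X)$ its class, so that $\omega_X^{-1}=\sum_{\rho\in\Sigma(1)}[D_\rho]$. For $L \in \operatorname{Pic}(X)$ let $H_L$ be the height on $X(\mathbf{Q})$ defined by the toric adelic norm: if $L=[D]$ with $D$ a $T$-invariant divisor, and if $\chi^{m_\sigma}$ is the character that is a local equation of $D$ on the affine chart $U_\sigma$ of a maximal cone $\sigma$, then the $v$-adic norm of the local generator $\chi^{-m_\sigma}$ of $\mathcal{O}(D)$ is $1$ at all points of $U_\sigma(\mathbf{Q}_v)$ at which $|\chi^m|_v\le 1$ for all characters $\chi^m$ regular on $U_\sigma$, and $H_L(P)=\prod_v\|y\|_v^{-1}$ for any nonzero rational point $y$ of the fibre of $\mathcal{O}(D)$ at $P$. The multi-height of $P\in X(\mathbf{Q})$ is the linear form $h(P)\in\operatorname{Pic}(X)^\vee_{\mathbf{R}}$ with $h(P)(L)=\log H_L(P)$. Let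 $\mathrm{D}_1\subset\operatorname{Pic}(X)^\vee_{\mathbf{R}}$ be a finite union of compact polyhedra, let $u$ be an element of the interior of the dual $C_{\mathrm{eff}}(X)^\vee$ of the effective cone, and put $\mathrm{D}_B=\mathrm{D}_1+\log(B)\,u$ for real $B\ge 1$. Then there is a constant $C>0$, depending only on $X$, $\mathrm{D}_1$ and $u$, such that for every real $B\ge 1$ the set $\{P\in X(\mathbf{Q})\setminus T(\mathbf{Q}) : h(P)\in\mathrm{D}_B\}$ is finite and $$\sharp\{P\in X(\mathbf{Q})\setminus T(\mathbf{Q}) : h(P)\in\mathrm{D}_B\}\;\le\; C\,\frac{B^{\langle\omega_X^{-1},u\rangle}}{B^{\min_{\rho\in\Sigma(1)}\langle[D_\rho],u\rangle}} .$$ (If $X$ is a point, $\Sigma(1)$ is empty, the minimum is read as $0$, and the set is empty.) -/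

import Mathlib

open CategoryTheory CategoryTheory.Limits AlgebraicGeometry

noncomputable section

/-- The cone in `N_ℝ = ℝ^d` generated by the vectors `gen ρ`, `ρ ∈ σ`. -/
def realCone {d : ℕ} {ι : Type} (gen : ι → Fin d → ℤ) (σ : Finset ι) : Set (Fin d → ℝ) :=
  {x | ∃ c : ι → ℝ, (∀ ρ, 0 ≤ c ρ) ∧ x = ∑ ρ ∈ σ, c ρ • (fun i => (gen ρ i : ℝ))}

/-- A smooth (regular) fan in `N = ℤ^d`. The index type `ι` is the set of rays, `gen ρ` is the
primitive generator of the ray `ρ`, and a cone of the fan is given by its finite set of rays. -/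
structure SmoothFan (d : ℕ) (ι : Type) [Fintype ι] [DecidableEq ι] where
  gen : ι → Fin d → ℤ
  cones : Set (Finset ι)
  empty_mem : ∅ ∈ cones
  singleton_mem : ∀ ρ : ι, {ρ} ∈ cones
  /-- Faces of cones are cones. -/
  face_mem : ∀ σ ∈ cones, ∀ τ ⊆ σ, τ ∈ cones
  /-- The generators of each cone are part of a `ℤ`-basis of `N`. -/
  regular : ∀ σ ∈ cones, ∃ (b : Module.Basis (Fin d) ℤ (Fin d → ℤ)) (e : σ ↪ Fin d),
    ∀ ρ : σ, b (e ρ) = gen ρ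
  /-- Two cones of the fan meet along a common face. -/
  inter : ∀ σ ∈ cones, ∀ τ ∈ cones, realCone gen σ ∩ realCone gen τ = realCone gen (σ ∩ τ)

namespace SmoothFan

variable {d : ℕ} {ι : Type} [Fintype ι] [DecidableEq ι] (F : SmoothFan d ι)

/-- The fan is complete: its cones cover `N_ℝ`. Equivalently, the toric variety is proper. -/
def IsComplete : Prop := ∀ x : Fin d → ℝ, ∃ σ ∈ F.cones, x ∈ realCone F.gen σ

/-- The pairing between a character `m ∈ M = ℤ^d` and the generator of the ray `ρ`. -/
def pair (m : Fin d → ℤ) (ρ : ι) : ℤ := m ⬝ᵥ F.gen ρ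

/-- The semigroup `σ^∨ ∩ M`. -/
def semigroup (σ : Finset ι) : AddSubmonoid (Fin d → ℤ) where
  carrier := {m | ∀ ρ ∈ σ, 0 ≤ F.pair m ρ}
  zero_mem' := by intro ρ _; simp [pair]
  add_mem' := by
    intro a b ha hb ρ hρ
    have h1 := ha ρ hρ
    have h2 := hb ρ hρ
    simp only [pair, add_dotProduct] at *
    omega

lemma semigroup_anti {σ τ : Finset ι} (h : τ ⊆ σ) : F.semigroup σ ≤ F.semigroup τ :=
  fun _ hm ρ hρ => hm ρ (h hρ)

/-- The coordinate ring `ℚ[σ^∨ ∩ M]` of the affine chart of the cone `σ`. -/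
abbrev chartRing (σ : Finset ι) : Type := AddMonoidAlgebra ℚ (F.semigroup σ)

/-- The character `χ^m`, for `m ∈ σ^∨ ∩ M`, as a function on the chart of `σ`. -/
def chi {σ : Finset ι} (m : F.semigroup σ) : F.chartRing σ := AddMonoidAlgebra.single m 1

/-- The restriction map `ℚ[σ^∨ ∩ M] → ℚ[τ^∨ ∩ M]` for a face `τ` of `σ`. -/
def restr {σ τ : Finset ι} (h : τ ⊆ σ) : F.chartRing σ →+* F.chartRing τ :=
  AddMonoidAlgebra.mapDomainRingHom ℚ (AddSubmonoid.inclusion (F.semigroup_anti h))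

lemma restr_chi {σ τ : Finset ι} (h : τ ⊆ σ) (m : F.semigroup σ) :
    F.restr h (F.chi m) = F.chi ⟨m, F.semigroup_anti h m.2⟩ := by
  simp [restr, chi]
  rfl

lemma chi_add {σ : Finset ι} (m n : F.semigroup σ) : F.chi (m + n) = F.chi m * F.chi n := by
  simp [chi, AddMonoidAlgebra.single_mul_single]

lemma chi_zero {σ : Finset ι} : F.chi (0 : F.semigroup σ) = 1 := by
  simp [chi, AddMonoidAlgebra.one_def]

lemma restr_refl {σ : Finset ι} (h : σ ⊆ σ) : F.restr h = RingHom.id _ :=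
  AddMonoidAlgebra.mapDomainRingHom_id

lemma restr_comp {σ τ υ : Finset ι} (h : τ ⊆ σ) (h' : υ ⊆ τ) :
    (F.restr h').comp (F.restr h) = F.restr (h'.trans h) :=
  (AddMonoidAlgebra.mapDomainRingHom_comp _ _).symm

lemma restr_injective {σ τ : Finset ι} (h : τ ⊆ σ) : Function.Injective (F.restr h) :=
  AddMonoidAlgebra.mapDomain_injective (AddSubmonoid.inclusion_injective _)

/-- The cones of the fan, ordered by inclusion of faces. -/
abbrev Cone : Type := {σ : Finset ι // σ ∈ F.cones}

/-- The diagram of the affine charts `Spec ℚ[σ^∨ ∩ M]`, with the inclusions of faces. -/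
def diagram : F.Cone ⥤ Scheme.{0} where
  obj σ := Spec (CommRingCat.of (F.chartRing σ.1))
  map f := Spec.map (CommRingCat.ofHom (F.restr (leOfHom f)))
  map_id σ := by
    rw [← Spec.map_id, restr_refl]
    rfl
  map_comp f g := by
    rw [← Spec.map_comp, ← CommRingCat.ofHom_comp, restr_comp]

/-- A `ℤ`-basis of `N` that contains the generators of `σ`, and its dual basis of `M`. -/
lemma exists_dual {σ : Finset ι} (hσ : σ ∈ F.cones) :
    ∃ (b b' : Fin d → Fin d → ℤ) (e : σ ↪ Fin d), (∀ ρ : σ, b (e ρ) = F.gen ρ) ∧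
      (∀ i j, b' i ⬝ᵥ b j = if i = j then 1 else 0) ∧
      ∀ m : Fin d → ℤ, m = ∑ i, (m ⬝ᵥ b i) • b' i := by
  obtain ⟨b, e, h⟩ := F.regular σ hσ
  refine ⟨b, fun i j => b.coord i (Pi.single j 1), e, h, ?_, ?_⟩
  · intro i j
    have : (fun k => b.coord i (Pi.single k 1)) ⬝ᵥ b j = b.coord i (b j) := by
      rw [LinearMap.pi_apply_eq_sum_univ (b.coord i) (b j)]
      simp only [dotProduct, smul_eq_mul]
      refine Finset.sum_congr rfl fun k _ => ?_
      rw [mul_comm]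
      congr 3
      ext l
      simp [Pi.single_apply, eq_comm]
    rw [this]
    simp [Finsupp.single_apply, eq_comm]
  · intro m
    ext j
    have h1 : m ⬝ᵥ (∑ i, b.coord i (Pi.single j 1) • b i) = m j := by
      have := b.sum_repr (Pi.single j 1)
      simp only [Module.Basis.coord_apply]
      rw [this]
      simp
    rw [← h1, dotProduct_sum, Finset.sum_apply]
    refine Finset.sum_congr rfl fun i _ => ?_
    rw [dotProduct_smul]
    simp [mul_comm]

/-- Elements `e_ρ ∈ M` with `⟨e_ρ, v_ρ'⟩ = δ_ρρ'` for all rays `ρ, ρ'` of `σ`. -/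
lemma exists_dual_family {σ : Finset ι} (hσ : σ ∈ F.cones) :
    ∃ e : ι → Fin d → ℤ, ∀ ρ ∈ σ, ∀ ρ' ∈ σ, F.pair (e ρ) ρ' = if ρ = ρ' then 1 else 0 := by
  obtain ⟨b, b', e, h, hb, -⟩ := F.exists_dual hσ
  refine ⟨fun ρ => if hρ : ρ ∈ σ then b' (e ⟨ρ, hρ⟩) else 0, fun ρ hρ ρ' hρ' => ?_⟩
  simp only [hρ, dif_pos, pair]
  rw [← h ⟨ρ', hρ'⟩, hb]
  simp

/-- A linear form that is nonnegative on `σ` and vanishes exactly on the face `τ`. -/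
lemma exists_sep {σ τ : Finset ι} (hσ : σ ∈ F.cones) (h : τ ⊆ σ) :
    ∃ m : F.semigroup σ, (∀ ρ ∈ τ, F.pair m ρ = 0) ∧ ∀ ρ ∈ σ, ρ ∉ τ → 1 ≤ F.pair m ρ := by
  obtain ⟨e, he⟩ := F.exists_dual_family hσ
  have key : ∀ ρ ∈ σ, F.pair (∑ ρ' ∈ σ \ τ, e ρ') ρ = if ρ ∈ τ then 0 else 1 := by
    intro ρ hρ
    have : F.pair (∑ ρ' ∈ σ \ τ, e ρ') ρ = ∑ ρ' ∈ σ \ τ, F.pair (e ρ') ρ := by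
      simp [pair, sum_dotProduct]
    rw [this, Finset.sum_congr rfl fun ρ' hρ' => he ρ' (Finset.mem_sdiff.1 hρ').1 ρ hρ]
    simp [hρ]
  refine ⟨⟨∑ ρ' ∈ σ \ τ, e ρ', fun ρ hρ => ?_⟩, fun ρ hρ => ?_, fun ρ hρ hρ' => ?_⟩
  · rw [key ρ hρ]; split_ifs <;> simp
  · simp [key ρ (h hρ), hρ]
  · simp [key ρ hρ, hρ']

/-- If `m` is nonnegative on `σ` and vanishes exactly on the face `τ`, then the chart of `τ` is the
open subset `χ^m ≠ 0` of the chart of `σ`. -/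
lemma isLocalization {σ τ : Finset ι} (h : τ ⊆ σ) (m : F.semigroup σ)
    (h0 : ∀ ρ ∈ τ, F.pair m ρ = 0) (h1 : ∀ ρ ∈ σ, ρ ∉ τ → 1 ≤ F.pair m ρ) :
    let _ := (F.restr h).toAlgebra
    IsLocalization.Away (F.chi m) (F.chartRing τ) := by
  let _ := (F.restr h).toAlgebra
  have hneg : -(m : Fin d → ℤ) ∈ F.semigroup τ := by
    intro ρ hρ
    have := h0 ρ hρ
    simp only [pair, neg_dotProduct] at *
    omega
  have hpow : ∀ k : ℕ, F.chi m ^ k = F.chi (k • m) := by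
    intro k
    simp [chi, AddMonoidAlgebra.single_pow]
  refine IsLocalization.Away.mk _ ?_ ?_ fun a b hab => ⟨0, ?_⟩
  · rw [RingHom.algebraMap_toAlgebra, restr_chi]
    refine IsUnit.of_mul_eq_one (F.chi ⟨_, hneg⟩) ?_
    rw [← chi_add, ← chi_zero]
    congr 1
    ext1
    simp
  · intro z
    suffices H : ∃ n : ℕ, ∀ k ≥ n, ∃ a, z * algebraMap (F.chartRing σ) (F.chartRing τ)
        (F.chi (k • m)) = algebraMap (F.chartRing σ) (F.chartRing τ) a by
      obtain ⟨n, hn⟩ := H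
      obtain ⟨a, ha⟩ := hn n le_rfl
      exact ⟨n, a, by rw [← map_pow, hpow, ha]⟩
    induction z using AddMonoidAlgebra.induction_linear with
    | zero => exact ⟨0, fun k _ => ⟨0, by simp⟩⟩
    | add x y hx hy =>
      obtain ⟨n, hn⟩ := hx
      obtain ⟨n', hn'⟩ := hy
      refine ⟨max n n', fun k hk => ?_⟩
      obtain ⟨a, ha⟩ := hn k (le_trans (le_max_left _ _) hk)
      obtain ⟨a', ha'⟩ := hn' k (le_trans (le_max_right _ _) hk)
      exact ⟨a + a', by rw [add_mul, ha, ha', map_add]⟩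
    | single s r =>
      refine ⟨∑ ρ ∈ σ, (F.pair s ρ).natAbs, fun k hk => ?_⟩
      have hmem : (s : Fin d → ℤ) + k • (m : Fin d → ℤ) ∈ F.semigroup σ := by
        intro ρ hρ
        have hs : F.pair ((s : Fin d → ℤ) + k • (m : Fin d → ℤ)) ρ
            = F.pair s ρ + k * F.pair m ρ := by
          rw [← natCast_zsmul]
          simp only [pair, add_dotProduct, smul_dotProduct, smul_eq_mul]
        rw [hs]
        by_cases hρτ : ρ ∈ τ
        · rw [h0 ρ hρτ]
          have := s.2 ρ hρτ
          simpa using this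
        · have hm := h1 ρ hρ hρτ
          have hle : (F.pair s ρ).natAbs ≤ k :=
            le_trans (Finset.single_le_sum (f := fun ρ => (F.pair s ρ).natAbs)
              (fun _ _ => Nat.zero_le _) hρ) hk
          have : (k : ℤ) * 1 ≤ k * F.pair m ρ := mul_le_mul_of_nonneg_left hm (by positivity)
          omega
      refine ⟨AddMonoidAlgebra.single ⟨_, hmem⟩ r, ?_⟩
      simp only [RingHom.algebraMap_toAlgebra, restr, chi,
        AddMonoidAlgebra.mapDomainRingHom_apply, AddMonoidAlgebra.mapDomain_single,
        AddMonoidAlgebra.single_mul_single, mul_one]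
      congr 1
  · simpa using F.restr_injective h hab

instance isOpenImmersion_map {σ τ : F.Cone} (f : σ ⟶ τ) : IsOpenImmersion (F.diagram.map f) := by
  obtain ⟨m, h0, h1⟩ := F.exists_sep τ.2 (leOfHom f)
  let _ := (F.restr (leOfHom f)).toAlgebra
  have := F.isLocalization (leOfHom f) m h0 h1
  exact IsOpenImmersion.of_isLocalization (F.chi m)

/-- A face chart is the open subset where a suitable character does not vanish. -/
lemma range_map {σ τ : F.Cone} (f : τ ⟶ σ) (m : F.semigroup σ.1)
    (h0 : ∀ ρ ∈ τ.1, F.pair m ρ = 0) (h1 : ∀ ρ ∈ σ.1, ρ ∉ τ.1 → 1 ≤ F.pair m ρ) :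
    Set.range (F.diagram.map f) =
      (PrimeSpectrum.basicOpen (F.chi m) : Set (PrimeSpectrum (F.chartRing σ.1))) := by
  let _ := (F.restr (leOfHom f)).toAlgebra
  have := F.isLocalization (leOfHom f) m h0 h1
  exact PrimeSpectrum.localization_away_comap_range (F.chartRing τ.1) (F.chi m)

instance isLocallyDirected : (F.diagram ⋙ Scheme.forget).IsLocallyDirected where
  cond {i j k} fi fj xi xj hx := by
    let l : F.Cone := ⟨i.1 ∩ j.1, F.face_mem _ i.2 _ Finset.inter_subset_left⟩
    let fli : l ⟶ i := homOfLE (Finset.inter_subset_left (s₁ := i.1) (s₂ := j.1))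
    let flj : l ⟶ j := homOfLE (Finset.inter_subset_right (s₁ := i.1) (s₂ := j.1))
    obtain ⟨m, hm0, hm1⟩ := F.exists_sep k.2 (leOfHom fi)
    obtain ⟨n, hn0, hn1⟩ := F.exists_sep k.2 (leOfHom fj)
    have hadd : ∀ ρ, F.pair ((m + n : F.semigroup k.1) : Fin d → ℤ) ρ
        = F.pair m ρ + F.pair n ρ := by
      intro ρ
      simp [pair, add_dotProduct]
    have hr := F.range_map (fli ≫ fi) (m + n)
      (fun ρ hρ => by
        rw [hadd, hm0 ρ (Finset.mem_inter.1 hρ).1, hn0 ρ (Finset.mem_inter.1 hρ).2]; rfl)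
      (fun ρ hρ hρ' => by
        rw [hadd]
        have h2 := m.2 ρ hρ
        have h3 := n.2 ρ hρ
        by_cases h : ρ ∈ i.1
        · have := hn1 ρ hρ (fun h' => hρ' (Finset.mem_inter.2 ⟨h, h'⟩))
          omega
        · have := hm1 ρ hρ h
          omega)
    change F.diagram.map fi xi = F.diagram.map fj xj at hx
    have hi : F.diagram.map fi xi ∈ Set.range (F.diagram.map fi) := ⟨xi, rfl⟩
    have hj : F.diagram.map fi xi ∈ Set.range (F.diagram.map fj) := ⟨xj, hx.symm⟩
    rw [F.range_map fi m hm0 hm1] at hi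
    rw [F.range_map fj n hn0 hn1] at hj
    have hl : F.diagram.map fi xi ∈ Set.range (F.diagram.map (fli ≫ fi)) := by
      rw [hr, chi_add, PrimeSpectrum.basicOpen_mul]
      exact ⟨hi, hj⟩
    obtain ⟨x, hx'⟩ := hl
    refine ⟨l, fli, flj, x, ?_, ?_⟩
    · apply (F.diagram.map fi).isOpenEmbedding.injective
      rw [← hx', Functor.map_comp]
      rfl
    · apply (F.diagram.map fj).isOpenEmbedding.injective
      rw [← hx, ← hx', Subsingleton.elim (fli ≫ fi) (flj ≫ fj), Functor.map_comp]
      rfl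

/-- The toric variety `X` over `ℚ` of the fan: the scheme obtained by gluing the affine charts
`Spec ℚ[σ^∨ ∩ M]` along common faces. -/
def toricVariety : Scheme.{0} := colimit F.diagram

/-- The open immersion of the chart of a cone into `X`. -/
def chart (σ : F.Cone) : Spec (CommRingCat.of (F.chartRing σ.1)) ⟶ F.toricVariety :=
  colimit.ι F.diagram σ

instance isOpenImmersion_chart (σ : F.Cone) : IsOpenImmersion (F.chart σ) :=
  inferInstanceAs (IsOpenImmersion (colimit.ι F.diagram σ))

/-- The inclusion of the chart of a face. -/
def chartMap {σ τ : Finset ι} (h : τ ⊆ σ) :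
    Spec (CommRingCat.of (F.chartRing τ)) ⟶ Spec (CommRingCat.of (F.chartRing σ)) :=
  Spec.map (CommRingCat.ofHom (F.restr h))

lemma isOpenImmersion_chartMap {σ τ : F.Cone} (h : τ.1 ⊆ σ.1) :
    IsOpenImmersion (F.chartMap h) := F.isOpenImmersion_map (homOfLE h)

lemma chartMap_chart {σ τ : F.Cone} (h : τ.1 ⊆ σ.1) : F.chartMap h ≫ F.chart σ = F.chart τ :=
  colimit.w F.diagram (homOfLE h)

/-- The set `X(ℚ)`. (A morphism of schemes from `Spec ℚ` is automatically one over `Spec ℚ`.) -/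
abbrev RatPoint : Type := Spec (CommRingCat.of ℚ) ⟶ F.toricVariety

/-- The rational point `P` lies in the chart of `σ`, where it is given by evaluating functions
by means of `x`. -/
def InChart (P : F.RatPoint) (σ : F.Cone) (x : F.chartRing σ.1 →+* ℚ) : Prop :=
  Spec.map (CommRingCat.ofHom x) ≫ F.chart σ = P

/-- The rational points of the open torus `T = Spec ℚ[M]`, the chart of the zero cone. -/
def torusPoints : Set F.RatPoint := {P | ∃ x, F.InChart P ⟨∅, F.empty_mem⟩ x}

lemma exists_inChart (P : F.RatPoint) : ∃ σ x, F.InChart P σ x := by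
  obtain ⟨σ, y, hy⟩ := Scheme.IsLocallyDirected.ι_jointly_surjective F.diagram
    (P (default : PrimeSpectrum ℚ))
  have hr : Set.range P ⊆ Set.range (F.chart σ) := by
    rintro _ ⟨t, rfl⟩
    rw [Subsingleton.elim (α := PrimeSpectrum ℚ) t default]
    exact ⟨y, hy⟩
  obtain ⟨x, hx⟩ := Spec.map_surjective (IsOpenImmersion.lift (F.chart σ) P hr)
  refine ⟨σ, x.hom, ?_⟩
  rw [InChart, CommRingCat.ofHom_hom, hx, IsOpenImmersion.lift_fac]

/-- A rational point in two charts lies in the chart of a common face. -/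
lemma exists_common {P : F.RatPoint} {σ τ : F.Cone} {x : F.chartRing σ.1 →+* ℚ}
    {y : F.chartRing τ.1 →+* ℚ} (hx : F.InChart P σ x) (hy : F.InChart P τ y) :
    ∃ (κ : F.Cone) (hσ : κ.1 ⊆ σ.1) (hτ : κ.1 ⊆ τ.1) (z : F.chartRing κ.1 →+* ℚ),
      F.InChart P κ z ∧ z.comp (F.restr hσ) = x ∧ z.comp (F.restr hτ) = y := by
  have h : colimit.ι F.diagram σ (Spec.map (CommRingCat.ofHom x) (default : PrimeSpectrum ℚ)) =
      colimit.ι F.diagram τ (Spec.map (CommRingCat.ofHom y) (default : PrimeSpectrum ℚ)) :=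
    congrArg (fun f : F.RatPoint => f (default : PrimeSpectrum ℚ)) (hx.trans hy.symm)
  obtain ⟨κ, f, g, t, ht, -⟩ := (Scheme.IsLocallyDirected.ι_eq_ι_iff F.diagram).1 h
  have hσ : κ.1 ⊆ σ.1 := leOfHom f
  have hτ : κ.1 ⊆ τ.1 := leOfHom g
  have := F.isOpenImmersion_chartMap hσ
  have hr : Set.range (Spec.map (CommRingCat.ofHom x)) ⊆ Set.range (F.chartMap hσ) := by
    rintro _ ⟨s, rfl⟩
    rw [Subsingleton.elim (α := PrimeSpectrum ℚ) s default]
    exact ⟨t, ht⟩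
  obtain ⟨z, hz⟩ := Spec.map_surjective
    (IsOpenImmersion.lift (F.chartMap hσ) (Spec.map (CommRingCat.ofHom x)) hr)
  have hzx : Spec.map z ≫ F.chartMap hσ = Spec.map (CommRingCat.ofHom x) := by
    rw [hz, IsOpenImmersion.lift_fac]
  have hP : F.InChart P κ z.hom := by
    rw [InChart, CommRingCat.ofHom_hom, ← F.chartMap_chart hσ, ← Category.assoc, hzx]
    exact hx
  have hzy : Spec.map z ≫ F.chartMap hτ = Spec.map (CommRingCat.ofHom y) := by
    rw [← cancel_mono (F.chart τ), Category.assoc, F.chartMap_chart hτ]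
    exact hP.trans hy.symm
  refine ⟨κ, hσ, hτ, z.hom, hP, ?_, ?_⟩
  · have : CommRingCat.ofHom (F.restr hσ) ≫ z = CommRingCat.ofHom x :=
      Spec.map_injective ((Spec.map_comp _ _).trans hzx)
    exact congrArg CommRingCat.Hom.hom this
  · have : CommRingCat.ofHom (F.restr hτ) ≫ z = CommRingCat.ofHom y :=
      Spec.map_injective ((Spec.map_comp _ _).trans hzy)
    exact congrArg CommRingCat.Hom.hom this

open Classical in
/-- The value `χ^n(P)` of the rational function `χ^n` at a rational point `P` in a neighbourhood
of which it is regular (it does not depend on the chart, see `charValue_eq`); `0` otherwise. -/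
def charValue (P : F.RatPoint) (n : Fin d → ℤ) : ℚ :=
  if h : ∃ (q : ℚ) (σ : F.Cone) (x : F.chartRing σ.1 →+* ℚ) (hn : n ∈ F.semigroup σ.1),
    F.InChart P σ x ∧ q = x (F.chi ⟨n, hn⟩) then h.choose else 0

lemma charValue_eq {P : F.RatPoint} {σ : F.Cone} {x : F.chartRing σ.1 →+* ℚ}
    (hx : F.InChart P σ x) (n : F.semigroup σ.1) : F.charValue P n = x (F.chi n) := by
  have h : ∃ (q : ℚ) (σ : F.Cone) (x : F.chartRing σ.1 →+* ℚ)
      (hn : (n : Fin d → ℤ) ∈ F.semigroup σ.1),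
      F.InChart P σ x ∧ q = x (F.chi ⟨n, hn⟩) := ⟨_, σ, x, n.2, hx, rfl⟩
  rw [charValue, dif_pos h]
  obtain ⟨τ, y, hn, hy, hq⟩ := h.choose_spec
  rw [hq]
  obtain ⟨κ, hσ, hτ, z, -, rfl, rfl⟩ := F.exists_common hx hy
  simp only [RingHom.comp_apply, restr_chi]

/-- The places of `ℚ`: the real place `none`, and the prime numbers. -/
abbrev Place : Type := Option Nat.Primes

/-- The normalized absolute value of a place of `ℚ`. -/
def placeAbs : Place → AbsoluteValue ℚ ℝ
  | none => Rat.AbsoluteValue.real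
  | some p => haveI := Fact.mk p.2; Rat.AbsoluteValue.padic p

/-- `P` is `v`-integral in the chart of `σ`: it lies in the compact subset of the `ℚ_v`-points of
the chart on which `|χ^m|_v ≤ 1` for all `m ∈ σ^∨ ∩ M`. -/
def IsIntegralIn (P : F.RatPoint) (v : Place) (σ : F.Cone) : Prop :=
  ∃ x, F.InChart P σ x ∧ ∀ m : F.semigroup σ.1, placeAbs v (x (F.chi m)) ≤ 1

/-- The group `Div_T(X) = ℤ^Σ(1)` of `T`-invariant divisors `∑ D_ρ`. -/
abbrev TDiv (_ : SmoothFan d ι) : Type := ι → ℤ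

/-- The divisor `∑ ⟨m, v_ρ⟩ D_ρ` of the character `χ^m`. -/
def divChar : (Fin d → ℤ) →+ F.TDiv where
  toFun m ρ := F.pair m ρ
  map_zero' := by ext; simp [pair]
  map_add' a b := by ext; simp [pair, add_dotProduct]

/-- The maximal (that is, `d`-dimensional) cones. -/
abbrev MaxCone : Type := {σ : F.Cone // σ.1.card = d}

/-- The local equation `m_σ(D) ∈ M` of a `T`-invariant divisor `D` on the chart of a maximal cone
`σ`: the character with `⟨m_σ(D), v_ρ⟩ = D_ρ` for all rays `ρ` of `σ`. -/
def localEq (σ : F.MaxCone) : F.TDiv →+ (Fin d → ℤ) where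
  toFun D := ∑ ρ ∈ σ.1.1, D ρ • (F.exists_dual_family σ.1.2).choose ρ
  map_zero' := by simp
  map_add' a b := by simp [add_smul, Finset.sum_add_distrib]

lemma pair_localEq (σ : F.MaxCone) (D : F.TDiv) {ρ : ι} (hρ : ρ ∈ σ.1.1) :
    F.pair (F.localEq σ D) ρ = D ρ := by
  have h := (F.exists_dual_family σ.1.2).choose_spec
  have : F.pair (F.localEq σ D) ρ =
      ∑ ρ' ∈ σ.1.1, D ρ' * F.pair ((F.exists_dual_family σ.1.2).choose ρ') ρ := by
    simp only [localEq, pair, AddMonoidHom.coe_mk, ZeroHom.coe_mk, sum_dotProduct,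
      smul_dotProduct, smul_eq_mul]
  rw [this, Finset.sum_congr rfl fun ρ' hρ' => by rw [h ρ' hρ' ρ hρ]]
  simp [hρ]

/-- For a maximal cone `σ` there is a basis of `M` whose nonnegative span is `σ^∨ ∩ M`. -/
lemma exists_maxBasis (σ : F.MaxCone) : ∃ (b' : Fin d → F.semigroup σ.1.1) (r : Fin d → ι),
    (∀ i, r i ∈ σ.1.1) ∧ ∀ m : Fin d → ℤ, m = ∑ i, F.pair m (r i) • (b' i : Fin d → ℤ) := by
  obtain ⟨b, b', e, he, hb, hm⟩ := F.exists_dual σ.1.2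
  have hbij : Function.Bijective e :=
    (Fintype.bijective_iff_injective_and_card _).2 ⟨e.injective, by simp [σ.2]⟩
  obtain ⟨r, -, hr⟩ := Function.bijective_iff_has_inverse.1 hbij
  have hbr : ∀ i, b i = F.gen (r i) := fun i => by rw [← he, hr i]
  refine ⟨fun i => ⟨b' i, fun ρ hρ => ?_⟩, fun i => r i, fun i => (r i).2, fun m => ?_⟩
  · rw [pair, ← he ⟨ρ, hρ⟩, hb]
    split_ifs <;> simp
  · simp only [pair, ← hbr]
    exact hm m

lemma localEq_divChar (σ : F.MaxCone) (m : Fin d → ℤ) : F.localEq σ (F.divChar m) = m := by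
  obtain ⟨b', r, hr, h⟩ := F.exists_maxBasis σ
  rw [h (F.localEq σ (F.divChar m)), h m]
  refine Finset.sum_congr rfl fun i _ => ?_
  rw [F.pair_localEq σ _ (hr i), ← h m]
  rfl

open Classical in
/-- A maximal cone in whose chart the point `P` of the chart of `σ₀` is `v`-integral (by
completeness of the fan there is one; `σ₀` is taken if possible). -/
def integralCone (P : F.RatPoint) (σ₀ : F.MaxCone) (v : Place) : F.MaxCone :=
  if F.IsIntegralIn P v σ₀.1 then σ₀
  else if h : ∃ σ : F.MaxCone, F.IsIntegralIn P v σ.1 then h.choose else σ₀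

/-- The toric adelic norm on `O(D)`. On the chart of a maximal cone `σ`, the invertible sheaf
`O(D)` is generated by `χ^(-m_σ(D))`, and the `v`-adic norm of this generator is `1` at all points
that are `v`-integral in that chart. For `P` in the chart of `σ₀`, this is the resulting `v`-adic
norm at `P` of the generator `χ^(-m_σ₀(D))`. -/
def genNorm (D : F.TDiv) (P : F.RatPoint) (σ₀ : F.MaxCone) (v : Place) : ℝ :=
  placeAbs v (F.charValue P (F.localEq (F.integralCone P σ₀ v) D - F.localEq σ₀ D))

open Classical in
/-- The height `H_D(P) = ∏_v ‖y‖_v⁻¹` of a rational point `P` with respect to `O(D)` with its toric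
adelic norm, where `y ≠ 0` is in the fibre of `O(D)` at `P`; we take for `y` the value at `P` of
the generator of `O(D)` on the chart of a maximal cone that contains `P`. -/
def height (D : F.TDiv) (P : F.RatPoint) : ℝ :=
  if h : ∃ σ₀ : F.MaxCone, ∃ x, F.InChart P σ₀.1 x then ∏ᶠ v, (F.genNorm D P h.choose v)⁻¹ else 1

lemma inChart_integralCone {P : F.RatPoint} {σ₀ : F.MaxCone} (h : ∃ x, F.InChart P σ₀.1 x)
    (v : Place) : ∃ x, F.InChart P (F.integralCone P σ₀ v).1 x := by
  by_cases h1 : F.IsIntegralIn P v σ₀.1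
  · rwa [integralCone, if_pos h1]
  · by_cases h2 : ∃ σ : F.MaxCone, F.IsIntegralIn P v σ.1
    · rw [integralCone, if_neg h1, dif_pos h2]
      obtain ⟨x, hx, -⟩ := h2.choose_spec
      exact ⟨x, hx⟩
    · rwa [integralCone, if_neg h1, dif_neg h2]

/-- `P` lies in the chart of a cone on which all `m_σ(D) - m_σ₀(D)` vanish, `σ` being the cone that
computes the `v`-adic norm. -/
lemma exists_units {P : F.RatPoint} {σ₀ : F.MaxCone} (h : ∃ x, F.InChart P σ₀.1 x) (v : Place) :
    ∃ (κ : F.Cone) (z : F.chartRing κ.1 →+* ℚ), F.InChart P κ z ∧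
      ∀ D, F.localEq (F.integralCone P σ₀ v) D - F.localEq σ₀ D ∈ F.semigroup κ.1 := by
  obtain ⟨x, hx⟩ := F.inChart_integralCone h v
  obtain ⟨y, hy⟩ := h
  obtain ⟨κ, h1, h2, z, hz, -, -⟩ := F.exists_common hx hy
  refine ⟨κ, z, hz, fun D ρ hρ => ?_⟩
  have e1 := F.pair_localEq (F.integralCone P σ₀ v) D (h1 hρ)
  have e2 := F.pair_localEq σ₀ D (h2 hρ)
  simp only [pair, sub_dotProduct] at *
  omega

lemma genNorm_add {P : F.RatPoint} {σ₀ : F.MaxCone} (h : ∃ x, F.InChart P σ₀.1 x) (v : Place)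
    (D D' : F.TDiv) : F.genNorm (D + D') P σ₀ v = F.genNorm D P σ₀ v * F.genNorm D' P σ₀ v := by
  obtain ⟨κ, z, hz, hm⟩ := F.exists_units h v
  unfold genNorm
  rw [F.charValue_eq hz ⟨_, hm D⟩, F.charValue_eq hz ⟨_, hm D'⟩, F.charValue_eq hz ⟨_, hm (D + D')⟩,
    ← map_mul, ← map_mul, ← chi_add]
  congr 4
  simp only [map_add]
  abel

lemma charValue_zero (P : F.RatPoint) : F.charValue P 0 = 1 := by
  obtain ⟨σ, x, hx⟩ := F.exists_inChart P
  have := F.charValue_eq hx 0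
  rwa [chi_zero, map_one] at this

lemma genNorm_zero (P : F.RatPoint) (σ₀ : F.MaxCone) (v : Place) : F.genNorm 0 P σ₀ v = 1 := by
  simp [genNorm, charValue_zero]

lemma genNorm_divChar (P : F.RatPoint) (σ₀ : F.MaxCone) (v : Place) (m : Fin d → ℤ) :
    F.genNorm (F.divChar m) P σ₀ v = 1 := by
  simp [genNorm, localEq_divChar, charValue_zero]

lemma genNorm_pos {P : F.RatPoint} {σ₀ : F.MaxCone} (h : ∃ x, F.InChart P σ₀.1 x) (v : Place)
    (D : F.TDiv) : 0 < F.genNorm D P σ₀ v := by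
  have h1 := F.genNorm_add h v D (-D)
  rw [add_neg_cancel, genNorm_zero] at h1
  refine lt_of_le_of_ne (AbsoluteValue.nonneg _ _) fun h0 => ?_
  rw [← h0, zero_mul] at h1
  exact one_ne_zero h1

lemma finite_placeAbs (q : ℚ) : {v : Place | ¬ placeAbs v q ≤ 1}.Finite := by
  have hfin : ((some ⁻¹' {v : Place | ¬ placeAbs v q ≤ 1}) : Set Nat.Primes).Finite := by
    refine Set.Finite.of_finite_image (f := fun p : Nat.Primes => (p : ℕ)) ?_
      Nat.Primes.coe_nat_injective.injOn
    refine (Nat.divisors q.den).finite_toSet.subset ?_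
    rintro _ ⟨p, hp, rfl⟩
    have := Fact.mk p.2
    simp only [Finset.mem_coe, Nat.mem_divisors]
    refine ⟨?_, q.den_nz⟩
    by_contra hd
    apply hp
    change ((padicNorm p q : ℚ) : ℝ) ≤ 1
    have h1 : padicNorm p q = padicNorm p q.num / padicNorm p (q.den : ℕ) := by
      rw [← padicNorm.div, Rat.num_div_den]
    have h2 : padicNorm p (q.den : ℕ) = 1 := (padicNorm.nat_eq_one_iff _).2 hd
    rw [h1, h2, div_one]
    exact_mod_cast padicNorm.of_int q.num
  refine ((hfin.image some).insert none).subset ?_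
  intro v hv
  cases v with
  | none => exact Set.mem_insert _ _
  | some p => exact Set.mem_insert_of_mem _ ⟨p, hv, rfl⟩

lemma finite_not_integral {P : F.RatPoint} {σ₀ : F.MaxCone} (h : ∃ x, F.InChart P σ₀.1 x) :
    {v : Place | ¬ F.IsIntegralIn P v σ₀.1}.Finite := by
  obtain ⟨x, hx⟩ := h
  obtain ⟨b', r, hr, hm⟩ := F.exists_maxBasis σ₀
  refine (Set.finite_iUnion fun i => finite_placeAbs (x (F.chi (b' i)))).subset ?_
  intro v hv
  by_contra hv'
  simp only [Set.mem_iUnion, Set.mem_ofPred_eq, not_exists, not_not] at hv'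
  refine hv ⟨x, hx, fun m => ?_⟩
  have hsum : m = ∑ i, (F.pair m (r i)).toNat • b' i := by
    ext1
    conv_lhs => rw [hm m]
    rw [AddSubmonoid.coe_finsetSum]
    refine Finset.sum_congr rfl fun i _ => ?_
    rw [AddSubmonoidClass.coe_nsmul, ← natCast_zsmul, Int.toNat_of_nonneg (m.2 _ (hr i))]
  have hprod : ∀ s : Finset (Fin d), ∀ k : Fin d → ℕ,
      placeAbs v (x (F.chi (∑ i ∈ s, k i • b' i))) ≤ 1 := by
    intro s k
    induction s using Finset.induction_on with
    | empty => simp [chi_zero]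
    | insert i s hi ih =>
      rw [Finset.sum_insert hi, chi_add, map_mul, map_mul]
      refine mul_le_one₀ ?_ (AbsoluteValue.nonneg _ _) ih
      have : F.chi (k i • b' i) = F.chi (b' i) ^ k i := by
        simp [chi, AddMonoidAlgebra.single_pow]
      rw [this, map_pow, map_pow]
      exact pow_le_one₀ (AbsoluteValue.nonneg _ _) (hv' i)
  rw [hsum]
  exact hprod _ _

lemma finite_mulSupport {P : F.RatPoint} {σ₀ : F.MaxCone} (h : ∃ x, F.InChart P σ₀.1 x)
    (D : F.TDiv) : (Function.mulSupport fun v => (F.genNorm D P σ₀ v)⁻¹).Finite := by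
  refine (F.finite_not_integral h).subset fun v hv hi => hv ?_
  simp [genNorm, integralCone, hi, charValue_zero]

lemma height_add (D D' : F.TDiv) (P : F.RatPoint) :
    F.height (D + D') P = F.height D P * F.height D' P := by
  unfold height
  split_ifs with h
  · rw [← finprod_mul_distrib (F.finite_mulSupport h.choose_spec D)
      (F.finite_mulSupport h.choose_spec D')]
    refine finprod_congr fun v => ?_
    rw [F.genNorm_add h.choose_spec, mul_inv]
  · simp

lemma height_divChar (m : Fin d → ℤ) (P : F.RatPoint) : F.height (F.divChar m) P = 1 := by
  unfold height
  simp [genNorm_divChar]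

lemma height_ne_zero (D : F.TDiv) (P : F.RatPoint) : F.height D P ≠ 0 := by
  intro h0
  have h1 := F.height_add D (-D) P
  have h2 := F.height_divChar 0 P
  rw [map_zero] at h2
  rw [add_neg_cancel, h2, h0, zero_mul] at h1
  exact one_ne_zero h1

/-- The Picard group `Pic(X)`: the classes of `T`-invariant divisors modulo those of characters. -/
abbrev Pic : Type := F.TDiv ⧸ F.divChar.range

/-- The class `[D] ∈ Pic(X)` of a `T`-invariant divisor. -/
def cls : F.TDiv →+ F.Pic := QuotientAddGroup.mk' F.divChar.range

/-- The class `[D_ρ]` of the `T`-invariant prime divisor of a ray `ρ`. -/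
def rayClass (ρ : ι) : F.Pic := F.cls (Pi.single ρ 1)

/-- The anticanonical class `ω_X⁻¹ = ∑ [D_ρ]`. -/
def anticanonical : F.Pic := ∑ ρ, F.rayClass ρ

/-- The real vector space `Pic(X)^∨_ℝ` of linear forms on the Picard group. -/
abbrev DualPic : Type := F.Pic →+ ℝ

/-- The topology of `Pic(X)^∨_ℝ` (pointwise convergence, the usual topology of this
finite-dimensional real vector space). -/
instance : TopologicalSpace F.DualPic :=
  TopologicalSpace.induced (fun a : F.DualPic => (a : F.Pic → ℝ)) inferInstance

/-- The multi-height `h(P) ∈ Pic(X)^∨_ℝ`, with `h(P)([D]) = log H_D(P)`. -/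
def multiHeight (P : F.RatPoint) : F.DualPic :=
  QuotientAddGroup.lift F.divChar.range
    { toFun := fun D => Real.log (F.height D P)
      map_zero' := by
        have := F.height_divChar 0 P
        rw [map_zero] at this
        rw [this, Real.log_one]
      map_add' := fun D D' => by
        rw [height_add, Real.log_mul (F.height_ne_zero D P) (F.height_ne_zero D' P)] }
    (by
      rintro _ ⟨m, rfl⟩
      change Real.log (F.height (F.divChar m) P) = 0
      rw [height_divChar, Real.log_one])

/-- A class is effective if its line bundle has a nonzero global section; since the torus acts on
the global sections, this means that the class contains an effective `T`-invariant divisor. -/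
def IsEffective (L : F.Pic) : Prop := ∃ D : F.TDiv, 0 ≤ D ∧ F.cls D = L

/-- The dual `C_eff(X)^∨` in `Pic(X)^∨_ℝ` of the cone generated by the effective classes. -/
def dualEffCone : Set F.DualPic := {a | ∀ L, F.IsEffective L → 0 ≤ a L}

/-- Compact polyhedra: compact intersections of finitely many closed half-spaces. -/
def IsCompactPolyhedron (K : Set F.DualPic) : Prop :=
  IsCompact K ∧ ∃ (k : ℕ) (l : Fin k → F.DualPic →ₗ[ℝ] ℝ) (c : Fin k → ℝ),
    K = {a | ∀ i, l i a ≤ c i}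

/-- Finite unions of compact polyhedra. -/
def IsFiniteUnionOfCompactPolyhedra (K : Set F.DualPic) : Prop :=
  ∃ (k : ℕ) (Q : Fin k → Set F.DualPic), (∀ i, F.IsCompactPolyhedron (Q i)) ∧ K = ⋃ i, Q i

/-- The translate `D_B = D₁ + log(B) u`. -/
def translate (D₁ : Set F.DualPic) (u : F.DualPic) (B : ℝ) : Set F.DualPic :=
  {a | ∃ b ∈ D₁, a = b + Real.log B • u}

/-- The points of `X(ℚ) ∖ T(ℚ)` whose multi-height lies in `D`. -/
def boundaryPoints (D : Set F.DualPic) : Set F.RatPoint :=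
  {P | P ∉ F.torusPoints ∧ F.multiHeight P ∈ D}

end SmoothFan
end

noncomputable section

namespace SmoothFan

/-! ### The product formula -/

/-! Over `ℚ` a point has integral homogeneous (Cox) coordinates, one for each ray, determined up to
signs once normalized at all primes. Their absolute values `Y ρ` are natural numbers with `Y ρ ≤
H_{D_ρ}(P)` off the orbit cone, and `Y ρ = 0` exactly when `ρ` is a ray of the cone whose torus
orbit contains `P`. If `h(P)` lies in `D_B`, then `Y ρ ≤ e^c B^{⟨[D_ρ],u⟩}` with `c` depending only
on `D₁`. A point outside `T` has some zero coordinate `ρ₀`, so the product of the ranges of the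
coordinates loses the factor `B^{⟨[D_ρ₀],u⟩}`, which is at least `B` to the minimal exponent; the
full product is `B^{⟨ω_X⁻¹,u⟩}` up to a constant.

Three facts carry this. Completeness puts `P` in an integral chart at every place
(`IsComplete.exists_isIntegralIn`), by moving a tropical vector into the star of the orbit cone. The
inverse `p`-adic absolute values of the local equations of `D_ρ` in these charts multiply to `Y ρ`
(`IsComplete.exists_coordinates`, with the product formula). A maximal chart, signs of a basis of
characters there and `Y` determine `P` (`eq_of_coordinates`), so the fibres of `P ↦ Y` are uniformly
bounded. -/

lemma finite_mulSupport_placeAbs {q : ℚ} (hq : q ≠ 0) :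
    Function.HasFiniteMulSupport fun v : Place => placeAbs v q := by
  -- Outside the finitely many places where `q` or `q⁻¹` has absolute value above 1, the absolute
  -- value is 1.
  refine ((finite_placeAbs q).union (finite_placeAbs q⁻¹)).subset fun v hv => ?_
  by_contra h
  simp only [Set.mem_union, Set.mem_ofPred_eq, not_or, not_not, map_inv₀] at h
  have hpos : 0 < placeAbs v q := (placeAbs v).pos hq
  exact hv (le_antisymm h.1 ((inv_le_one₀ hpos).1 h.2))

lemma finprod_placeAbs_mul {q r : ℚ} (hq : q ≠ 0) (hr : r ≠ 0) :
    ∏ᶠ v, placeAbs v (q * r) = (∏ᶠ v, placeAbs v q) * ∏ᶠ v, placeAbs v r := by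
  rw [← finprod_mul_distrib (finite_mulSupport_placeAbs hq) (finite_mulSupport_placeAbs hr)]
  simp only [map_mul]

/-- Multiplicativity reduces this to a prime `p`, where only the real place and `p` contribute, with
factors `p` and `p⁻¹`. -/
lemma finprod_placeAbs_natCast (n : ℕ) (hn : n ≠ 0) : ∏ᶠ v, placeAbs v (n : ℚ) = 1 := by
  induction n using Nat.recOnMul with
  | zero => exact absurd rfl hn
  | one => simp
  | prime p hp =>
    have hq : (p : ℚ) ≠ 0 := by exact_mod_cast hn
    rw [finprod_option (f := fun v => placeAbs v (p : ℚ))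
      ((finite_mulSupport_placeAbs hq).preimage (Option.some_injective _).injOn),
      finprod_eq_single (fun l : Nat.Primes => placeAbs (some l) (p : ℚ)) ⟨p, hp⟩]
    · have := Fact.mk hp
      change |((p : ℚ) : ℝ)| * ((padicNorm p p : ℚ) : ℝ) = 1
      rw [padicNorm.padicNorm_p_of_prime]
      have : (p : ℝ) ≠ 0 := by exact_mod_cast hn
      simp [this]
    · intro l hl
      have := Fact.mk l.2
      change ((padicNorm l p : ℚ) : ℝ) = 1
      rw [(padicNorm.nat_eq_one_iff _).2, Rat.cast_one]
      rw [Nat.prime_dvd_prime_iff_eq l.2 hp]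
      exact fun h => hl (Subtype.ext h)
  | mul a b ha hb =>
    have ha0 := left_ne_zero_of_mul hn
    have hb0 := right_ne_zero_of_mul hn
    rw [Nat.cast_mul, finprod_placeAbs_mul (by exact_mod_cast ha0) (by exact_mod_cast hb0),
      ha ha0, hb hb0, one_mul]

/-- The product formula for `ℚ`. -/
theorem finprod_placeAbs {q : ℚ} (hq : q ≠ 0) : ∏ᶠ v, placeAbs v q = 1 := by
  have hd : (q.den : ℚ) ≠ 0 := by exact_mod_cast q.den_nz
  have h := finprod_placeAbs_mul hq hd
  rw [Rat.mul_den_eq_num, finprod_placeAbs_natCast _ q.den_nz, mul_one] at h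
  rw [← h, ← finprod_placeAbs_natCast q.num.natAbs (by simpa using hq)]
  refine finprod_congr fun v => ?_
  rcases Int.natAbs_eq q.num with h' | h'
  · conv_lhs => rw [h']
    rw [Int.cast_natCast]
  · conv_lhs => rw [h']
    rw [Int.cast_neg, map_neg_eq_map, Int.cast_natCast]

/-- The inverse is `p` to the valuation of `q`, here a nonnegative exponent. This makes the
coordinates of a point natural numbers. -/
lemma placeAbs_prime_inv_mem_natCast {p : Nat.Primes} {q : ℚ} (hq : q ≠ 0)
    (h : placeAbs (some p) q ≤ 1) : ∃ n : ℕ, 0 < n ∧ (placeAbs (some p) q)⁻¹ = n := by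
  have := Fact.mk p.2
  have hp : (1 : ℝ) < (p : ℕ) := by exact_mod_cast p.2.one_lt
  have hv : placeAbs (some p) q = ((p : ℕ) : ℝ) ^ (-padicValRat p q) := by
    change ((padicNorm p q : ℚ) : ℝ) = _
    rw [padicNorm.eq_zpow_of_nonzero hq]
    push_cast
    rfl
  rw [hv] at h ⊢
  have h0 : 0 ≤ padicValRat p q := by
    by_contra h0
    exact absurd h (not_le.2 (one_lt_zpow₀ hp (by omega)))
  refine ⟨(p : ℕ) ^ (padicValRat p q).toNat, pow_pos p.2.pos _, ?_⟩
  rw [zpow_neg, inv_inv, Nat.cast_pow, ← zpow_natCast, Int.toNat_of_nonneg h0]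

/-! ### Cones of a complete fan -/

variable {d : ℕ} {ι : Type} [Fintype ι] [DecidableEq ι] (F : SmoothFan d ι)

/-- A regular cone is cut out by the coordinate forms of a basis. -/
lemma exists_mem_realCone_iff {σ : Finset ι} (hσ : σ ∈ F.cones) :
    ∃ (f : Fin d → Module.Dual ℝ (Fin d → ℝ)) (I : Finset (Fin d)), I.card = σ.card ∧
      (∀ i, ∃ x, f i x ≠ 0) ∧
      ∀ x, x ∈ realCone F.gen σ ↔ (∀ i ∈ I, 0 ≤ f i x) ∧ ∀ i ∉ I, f i x = 0 := by
  obtain ⟨b, b', e, he, hb, hm⟩ := F.exists_dual hσ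
  let bR : Fin d → Fin d → ℝ := fun i j => (b i j : ℝ)
  let bR' : Fin d → Fin d → ℝ := fun i j => (b' i j : ℝ)
  have hbR : ∀ i j, bR' i ⬝ᵥ bR j = if i = j then 1 else 0 := by
    intro i j
    have := congrArg (Int.cast : ℤ → ℝ) (hb i j)
    simp only [dotProduct, Int.cast_sum, Int.cast_mul, Int.cast_ite, Int.cast_one,
      Int.cast_zero] at this
    exact this
  have hmat : (Matrix.of bR') * (Matrix.of bR).transpose = 1 := by
    ext i j
    rw [Matrix.mul_apply, Matrix.one_apply]
    exact hbR i j
  have hexp : ∀ x : Fin d → ℝ, x = ∑ i, (bR' i ⬝ᵥ x) • bR i := by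
    intro x
    -- The one-sided inverse of a square matrix is two-sided, so duality of the bases yields the
    -- expansion of `x`.
    have h := congrArg (Matrix.mulVec · x) (mul_eq_one_comm.1 hmat)
    simp only [Matrix.one_mulVec, ← Matrix.mulVec_mulVec] at h
    conv_lhs => rw [← h]
    ext j
    simp only [Matrix.mulVec, dotProduct, Matrix.transpose_apply, Matrix.of_apply,
      Finset.sum_apply, Pi.smul_apply, smul_eq_mul]
    exact Finset.sum_congr rfl fun i _ => mul_comm _ _
  have hgen : ∀ ρ : σ, bR (e ρ) = fun i => (F.gen ρ i : ℝ) := fun ρ => by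
    ext i
    simp only [bR, he]
  refine ⟨fun i => dotProductBilin ℝ ℝ (bR' i), Finset.univ.map e, by simp,
    fun i => ⟨bR i, ?_⟩, fun x => ?_⟩
  · change bR' i ⬝ᵥ bR i ≠ 0
    simp [hbR]
  change _ ↔ (∀ i ∈ Finset.univ.map e, 0 ≤ bR' i ⬝ᵥ x) ∧ ∀ i ∉ Finset.univ.map e, bR' i ⬝ᵥ x = 0
  constructor
  · rintro ⟨c, hc, rfl⟩
    have key : ∀ i, bR' i ⬝ᵥ (∑ ρ ∈ σ, c ρ • fun j => (F.gen ρ j : ℝ)) =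
        ∑ ρ : σ, c ρ * if i = e ρ then 1 else 0 := by
      intro i
      rw [← Finset.sum_coe_sort, dotProduct_sum]
      refine Finset.sum_congr rfl fun ρ _ => ?_
      rw [← hgen, dotProduct_smul, hbR, smul_eq_mul]
    refine ⟨fun i _ => ?_, fun i hi => ?_⟩
    · rw [key]
      refine Finset.sum_nonneg fun ρ _ => mul_nonneg (hc _) ?_
      split_ifs <;> simp
    · rw [key]
      refine Finset.sum_eq_zero fun ρ _ => ?_
      rw [if_neg fun h => hi (by simp [h]), mul_zero]
  · rintro ⟨h1, h2⟩
    refine ⟨fun ρ => if h : ρ ∈ σ then bR' (e ⟨ρ, h⟩) ⬝ᵥ x else 0, fun ρ => ?_, ?_⟩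
    · dsimp only
      split_ifs with h
      · exact h1 _ (by simp)
      · exact le_rfl
    · rw [← Finset.sum_coe_sort]
      conv_lhs => rw [hexp x]
      rw [← Finset.sum_subset (Finset.subset_univ (Finset.univ.map e))
        fun i _ hi => by rw [h2 i hi, zero_smul], Finset.sum_map]
      refine Finset.sum_congr rfl fun ρ _ => ?_
      simp [← hgen]

/-! ### Interior vectors and stars of cones -/

/-- The sum of the generators of a cone, an element of its relative interior. -/
def interiorVector (κ : Finset ι) : Fin d → ℝ := ∑ ρ ∈ κ, fun i => (F.gen ρ i : ℝ)

lemma dotProduct_gen (m : Fin d → ℤ) (ρ : ι) :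
    (fun i => (m i : ℝ)) ⬝ᵥ (fun i => (F.gen ρ i : ℝ)) = F.pair m ρ := by
  simp [pair, dotProduct]

lemma dotProduct_interiorVector (m : Fin d → ℤ) (κ : Finset ι) :
    (fun i => (m i : ℝ)) ⬝ᵥ F.interiorVector κ = ∑ ρ ∈ κ, (F.pair m ρ : ℝ) := by
  simp only [interiorVector, dotProduct_sum, dotProduct_gen]

lemma interiorVector_mem (κ : Finset ι) : F.interiorVector κ ∈ realCone F.gen κ :=
  ⟨fun _ => 1, fun _ => zero_le_one, by simp [interiorVector]⟩

/-- By the intersection axiom the vector lies in the cone of `κ ∩ σ`. For a ray of `κ` not in `σ`,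
the dual form is 1 on the interior vector but 0 on that common face. -/
lemma subset_of_interiorVector_mem {κ σ : Finset ι} (hκ : κ ∈ F.cones) (hσ : σ ∈ F.cones)
    (h : F.interiorVector κ ∈ realCone F.gen σ) : κ ⊆ σ := by
  have hmem : F.interiorVector κ ∈ realCone F.gen (κ ∩ σ) := by
    rw [← F.inter κ hκ σ hσ]
    exact ⟨F.interiorVector_mem κ, h⟩
  obtain ⟨c, -, hc⟩ := hmem
  obtain ⟨e, he⟩ := F.exists_dual_family hκ
  intro ρ hρ
  by_contra hρσ
  have h1 := F.dotProduct_interiorVector (e ρ) κ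
  have h2 : ∑ ρ' ∈ κ, (F.pair (e ρ) ρ' : ℝ) = 1 := by
    rw [Finset.sum_congr rfl fun ρ' hρ' => congrArg (Int.cast : ℤ → ℝ) (he ρ hρ ρ' hρ')]
    simp [hρ]
  rw [h2, hc, dotProduct_sum] at h1
  refine zero_ne_one ((Finset.sum_eq_zero fun ρ' hρ' => ?_).symm.trans h1)
  obtain ⟨h3, h4⟩ := Finset.mem_inter.1 hρ'
  rw [dotProduct_smul, dotProduct_gen, he ρ hρ ρ' h3,
    if_neg (fun h : ρ = ρ' => hρσ (by rwa [h]))]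
  simp

variable {F}

/-- Every vector is moved by a multiple of the interior vector of a cone `κ` into a cone of the
star of `κ`. -/
lemma IsComplete.exists_add_mem (hF : F.IsComplete) {κ : Finset ι} (hκ : κ ∈ F.cones)
    (x : Fin d → ℝ) : ∃ σ ∈ F.cones, κ ⊆ σ ∧
      ∃ k : ℕ, x + (k : ℝ) • F.interiorVector κ ∈ realCone F.gen σ ∧
        F.interiorVector κ ∈ realCone F.gen σ := by
  choose σ hσ hx using fun k : ℕ => hF (x + (k : ℝ) • F.interiorVector κ)
  -- Pigeonhole: one cone `τ` contains `x + k s` for infinitely many `k`, where `s` is the interior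
  -- vector; hence `s` is a recession direction of `τ` and lies in it.
  obtain ⟨τ, hτ⟩ := Finite.exists_infinite_fiber σ
  have hinf : (σ ⁻¹' {τ}).Infinite := Set.infinite_coe_iff.1 hτ
  have hτmem : ∀ k ∈ σ ⁻¹' {τ}, x + (k : ℝ) • F.interiorVector κ ∈ realCone F.gen τ := by
    rintro k rfl
    exact hx k
  obtain ⟨k₀, hk₀⟩ := hinf.nonempty
  have hτc : τ ∈ F.cones := by
    have := hσ k₀
    rwa [show σ k₀ = τ from hk₀] at this
  obtain ⟨f, I, -, -, hf⟩ := F.exists_mem_realCone_iff hτc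
  have hs : F.interiorVector κ ∈ realCone F.gen τ := by
    rw [hf]
    refine ⟨fun i hi => ?_, fun i hi => ?_⟩
    -- If `f i s` were negative, `f i x + k * f i s` would be negative for large `k`.
    · by_contra! hneg
      obtain ⟨n, hn⟩ := exists_nat_gt (f i x / -(f i (F.interiorVector κ)))
      obtain ⟨k, hk, hnk⟩ := hinf.exists_gt n
      have h1 := ((hf _).1 (hτmem k hk)).1 i hi
      rw [map_add, map_smul, smul_eq_mul] at h1
      rw [div_lt_iff₀ (by linarith)] at hn
      have h2 : (n : ℝ) ≤ k := by exact_mod_cast hnk.le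
      nlinarith
    -- An affine function of `k` with two zeros has slope zero.
    · obtain ⟨k, hk, hnk⟩ := hinf.exists_gt k₀
      have h1 := ((hf _).1 (hτmem k hk)).2 i hi
      have h2 := ((hf _).1 (hτmem k₀ hk₀)).2 i hi
      rw [map_add, map_smul, smul_eq_mul] at h1 h2
      have h3 : ((k : ℝ) - k₀) * f i (F.interiorVector κ) = 0 := by linarith
      have h4 : (k : ℝ) - k₀ ≠ 0 := by
        rw [sub_ne_zero]
        exact_mod_cast hnk.ne'
      exact (mul_eq_zero.1 h3).resolve_left h4
  exact ⟨τ, hτc, F.subset_of_interiorVector_mem hκ hτc hs, k₀, hτmem k₀ hk₀, hs⟩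

/-- In a complete fan every cone is a face of a `d`-dimensional cone. -/
lemma IsComplete.exists_maxCone (hF : F.IsComplete) (κ : F.Cone) :
    ∃ σ : F.MaxCone, κ.1 ⊆ σ.1.1 := by
  choose f I hI hf0 hf using fun σ : F.Cone => F.exists_mem_realCone_iff σ.2
  -- A generic `w` avoids all coordinate hyperplanes of all cones. A lower-dimensional cone
  -- containing `w + k s` and `s` would have an equation satisfied by `w`.
  obtain ⟨w, hw⟩ := Module.Dual.exists_forall_ne_zero_of_forall_exists
    (fun a : F.Cone × Fin d => f a.1 a.2) fun a => hf0 a.1 a.2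
  obtain ⟨σ, hσ, hκσ, k, hk, hs⟩ := hF.exists_add_mem κ.2 w
  refine ⟨⟨⟨σ, hσ⟩, ?_⟩, hκσ⟩
  rw [← hI ⟨σ, hσ⟩]
  suffices I ⟨σ, hσ⟩ = Finset.univ by rw [this, Finset.card_fin]
  rw [Finset.eq_univ_iff_forall]
  intro i
  by_contra hi
  have h1 := ((hf ⟨σ, hσ⟩ _).1 hk).2 i hi
  have h2 := ((hf ⟨σ, hσ⟩ _).1 hs).2 i hi
  rw [map_add, map_smul, h2, smul_zero, add_zero] at h1
  exact hw (⟨σ, hσ⟩, i) h1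

end SmoothFan

namespace SmoothFan

variable {d : ℕ} {ι : Type} [Fintype ι] [DecidableEq ι] (F : SmoothFan d ι)

/-! ### The torus orbit of a rational point -/

lemma pair_add (m n : Fin d → ℤ) (ρ : ι) : F.pair (m + n) ρ = F.pair m ρ + F.pair n ρ :=
  add_dotProduct _ _ _

lemma pair_neg (m : Fin d → ℤ) (ρ : ι) : F.pair (-m) ρ = -F.pair m ρ :=
  neg_dotProduct _ _

lemma inChart_of_subset {P : F.RatPoint} {σ τ : F.Cone} (h : τ.1 ⊆ σ.1)
    {x : F.chartRing τ.1 →+* ℚ} (hx : F.InChart P τ x) :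
    F.InChart P σ (x.comp (F.restr h)) := by
  rw [← hx, InChart, ← F.chartMap_chart h, chartMap, CommRingCat.ofHom_comp, Spec.map_comp,
    Category.assoc]

/-- If `χ^m` does not vanish at `P`, then `P` lies in the chart of the face on which `m`
vanishes. -/
lemma exists_inChart_face {P : F.RatPoint} {σ : F.Cone} {x : F.chartRing σ.1 →+* ℚ}
    (hx : F.InChart P σ x) (m : F.semigroup σ.1) (hm : x (F.chi m) ≠ 0) :
    ∃ (τ : F.Cone) (z : F.chartRing τ.1 →+* ℚ), F.InChart P τ z ∧
      τ.1 = {ρ ∈ σ.1 | F.pair m ρ = 0} := by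
  have hsub : {ρ ∈ σ.1 | F.pair m ρ = 0} ⊆ σ.1 := Finset.filter_subset _ _
  let τ : F.Cone := ⟨_, F.face_mem _ σ.2 _ hsub⟩
  let _ := (F.restr hsub).toAlgebra
  have := F.isLocalization hsub m (fun ρ hρ => (Finset.mem_filter.1 hρ).2) fun ρ hρ hρ' => by
    have h1 := m.2 ρ hρ
    have h2 : F.pair m ρ ≠ 0 := fun h => hρ' (Finset.mem_filter.2 ⟨hρ, h⟩)
    omega
  let z : F.chartRing τ.1 →+* ℚ := IsLocalization.Away.lift (F.chi m) (Ne.isUnit hm)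
  have hz : z.comp (F.restr hsub) = x := IsLocalization.Away.lift_comp (F.chi m) (Ne.isUnit hm)
  refine ⟨τ, z, ?_, rfl⟩
  rw [← hx, ← hz, InChart, ← F.chartMap_chart (σ := σ) (τ := τ) hsub, chartMap,
    CommRingCat.ofHom_comp, Spec.map_comp, Category.assoc]

/-- A rational point lies in the torus orbit of a cone `κ`. -/
lemma exists_orbitCone (P : F.RatPoint) : ∃ κ : F.Cone, (∃ z, F.InChart P κ z) ∧
    ∀ (σ : F.Cone) (x : F.chartRing σ.1 →+* ℚ), F.InChart P σ x →
      κ.1 ⊆ σ.1 ∧ ∀ m : F.semigroup σ.1, x (F.chi m) ≠ 0 ↔ ∀ ρ ∈ κ.1, F.pair m ρ = 0 := by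
  -- The orbit cone is the one with fewest rays among those whose charts contain `P`. Charts
  -- containing `P` share a face chart containing it, so minimality places `κ` inside each of them.
  obtain ⟨κ, ⟨z, hz⟩, hmin⟩ := Set.exists_min_image {κ : F.Cone | ∃ z, F.InChart P κ z}
    (fun κ => κ.1.card) (Set.toFinite _) (by obtain ⟨σ, x, hx⟩ := F.exists_inChart P
                                             exact ⟨σ, x, hx⟩)
  refine ⟨κ, ⟨z, hz⟩, fun σ x hx => ?_⟩
  have hκσ : κ.1 ⊆ σ.1 := by
    obtain ⟨τ, h1, h2, y, hy, -, -⟩ := F.exists_common hz hx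
    rwa [Finset.eq_of_subset_of_card_le h1 (hmin τ ⟨y, hy⟩)] at h2
  refine ⟨hκσ, fun m => ?_⟩
  have hzm : z (F.chi ⟨m, F.semigroup_anti hκσ m.2⟩) = x (F.chi m) := by
    rw [← F.charValue_eq hx, ← F.charValue_eq hz]
  rw [← hzm]
  constructor
  -- A nonvanishing `χ^m` puts `P` in the chart of the face of `κ` where `m` vanishes; by minimality
  -- this face is `κ`.
  · intro hm ρ hρ
    obtain ⟨τ, y, hy, hτ⟩ := F.exists_inChart_face hz _ hm
    have h := hmin τ ⟨y, hy⟩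
    have h1 : τ.1 ⊆ κ.1 := by rw [hτ]; exact Finset.filter_subset _ _
    rw [← Finset.eq_of_subset_of_card_le h1 h, hτ] at hρ
    exact (Finset.mem_filter.1 hρ).2
  · intro hm h0
    have hneg : -(m : Fin d → ℤ) ∈ F.semigroup κ.1 := fun ρ hρ => by
      rw [pair_neg, hm ρ hρ, neg_zero]
    have h1 : z (F.chi ⟨m, F.semigroup_anti hκσ m.2⟩) * z (F.chi ⟨_, hneg⟩) = 1 := by
      rw [← map_mul, ← chi_add, ← map_one z, ← chi_zero]
      congr 2
      ext1
      simp
    rw [h0, zero_mul] at h1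
    exact zero_ne_one h1

/-- The cone whose torus orbit contains `P`. -/
def orbitCone (P : F.RatPoint) : F.Cone := (F.exists_orbitCone P).choose

lemma exists_inChart_orbitCone (P : F.RatPoint) : ∃ z, F.InChart P (F.orbitCone P) z :=
  (F.exists_orbitCone P).choose_spec.1

variable {F} in
lemma InChart.orbitCone_subset {P : F.RatPoint} {σ : F.Cone} {x : F.chartRing σ.1 →+* ℚ}
    (hx : F.InChart P σ x) : (F.orbitCone P).1 ⊆ σ.1 :=
  ((F.exists_orbitCone P).choose_spec.2 σ x hx).1

variable {F} in
lemma InChart.apply_chi_ne_zero_iff {P : F.RatPoint} {σ : F.Cone} {x : F.chartRing σ.1 →+* ℚ}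
    (hx : F.InChart P σ x) (m : F.semigroup σ.1) :
    x (F.chi m) ≠ 0 ↔ ∀ ρ ∈ (F.orbitCone P).1, F.pair m ρ = 0 :=
  ((F.exists_orbitCone P).choose_spec.2 σ x hx).2 m

lemma orbitCone_nonempty {P : F.RatPoint} (hP : P ∉ F.torusPoints) :
    (F.orbitCone P).1.Nonempty := by
  rw [Finset.nonempty_iff_ne_empty]
  intro h
  have hz := F.exists_inChart_orbitCone P
  have h' : F.orbitCone P = ⟨∅, F.empty_mem⟩ := Subtype.ext h
  rw [h'] at hz
  exact hP hz

/-- The value at `P` of the characters that are invertible at `P` extends to a homomorphism on all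
characters. -/
lemma exists_orbitChar (P : F.RatPoint) : ∃ E : Multiplicative (Fin d → ℤ) →* ℚˣ,
    ∀ m : Fin d → ℤ, (∀ ρ ∈ (F.orbitCone P).1, F.pair m ρ = 0) →
      F.charValue P m = E (Multiplicative.ofAdd m) := by
  classical
  obtain ⟨z, hz⟩ := F.exists_inChart_orbitCone P
  obtain ⟨b, b', e, he, hb, hm⟩ := F.exists_dual (F.orbitCone P).2
  -- `U` consists of the characters invertible at `P`. It is a direct summand of `M`, so its values
  -- extend through a projection.
  let U : AddSubgroup (Fin d → ℤ) :=
    { carrier := {m | ∀ ρ ∈ (F.orbitCone P).1, F.pair m ρ = 0}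
      zero_mem' := fun ρ _ => zero_dotProduct _
      add_mem' := fun ha hb ρ hρ => by rw [pair_add, ha ρ hρ, hb ρ hρ, add_zero]
      neg_mem' := fun ha ρ hρ => by rw [pair_neg, ha ρ hρ, neg_zero] }
  have hU : ∀ m : U, (m : Fin d → ℤ) ∈ F.semigroup (F.orbitCone P).1 := fun m ρ hρ =>
    (m.2 ρ hρ).ge
  let φ : Multiplicative U →* ℚ :=
    { toFun := fun m => z (F.chi ⟨m.toAdd, hU m.toAdd⟩)
      map_one' := by
        rw [← map_one z, ← chi_zero]
        rfl
      map_mul' := fun m n => by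
        rw [← map_mul, ← chi_add]
        rfl }
  let φ' : Multiplicative U →* ℚˣ := MonoidHom.toHomUnits φ
  -- `π` discards the dual basis vectors outside `U`. These are dual to rays of the orbit cone, so
  -- elements of `U` have coefficient 0 there and `π` fixes `U`.
  let π : (Fin d → ℤ) →+ U :=
    { toFun := fun m => ∑ i, (m ⬝ᵥ b i) • if h : b' i ∈ U then ⟨b' i, h⟩ else 0
      map_zero' := by simp
      map_add' := fun m n => by simp only [add_dotProduct, add_smul, Finset.sum_add_distrib] }
  have hπ : ∀ m ∈ U, (π m : Fin d → ℤ) = m := by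
    intro m hmU
    change ((∑ i, (m ⬝ᵥ b i) • if h : b' i ∈ U then (⟨b' i, h⟩ : U) else 0 : U) : Fin d → ℤ) = m
    conv_rhs => rw [hm m]
    rw [AddSubgroup.val_finsetSum]
    refine Finset.sum_congr rfl fun i _ => ?_
    split_ifs with h
    · rfl
    · obtain ⟨ρ, hρ, hne⟩ : ∃ ρ ∈ (F.orbitCone P).1, F.pair (b' i) ρ ≠ 0 := by
        by_contra! h'
        exact h h'
      rw [pair, ← he ⟨ρ, hρ⟩, hb] at hne
      have hi : i = e ⟨ρ, hρ⟩ := by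
        by_contra h'
        exact hne (if_neg h')
      have h0 : m ⬝ᵥ b i = 0 := by
        rw [hi, he]
        exact hmU ρ hρ
      rw [h0, zero_smul, zero_smul]
      rfl
  refine ⟨φ'.comp (AddMonoidHom.toMultiplicative π), fun m hmU => ?_⟩
  change F.charValue P m = z (F.chi ⟨π m, hU (π m)⟩)
  rw [← F.charValue_eq hz]
  exact congrArg _ (hπ m hmU).symm

/-- An extension to all characters of the value at `P` of those that are invertible at `P`. -/
def orbitChar (P : F.RatPoint) : Multiplicative (Fin d → ℤ) →* ℚˣ := (F.exists_orbitChar P).choose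

lemma charValue_eq_orbitChar {P : F.RatPoint} {m : Fin d → ℤ}
    (hm : ∀ ρ ∈ (F.orbitCone P).1, F.pair m ρ = 0) :
    F.charValue P m = F.orbitChar P (Multiplicative.ofAdd m) :=
  (F.exists_orbitChar P).choose_spec m hm

/-! ### Integral charts -/

variable {F}

/-- The toric variety of a complete fan satisfies the valuative criterion of properness at every
place: a rational point is integral in some chart. -/
lemma IsComplete.exists_isIntegralIn (hF : F.IsComplete) (P : F.RatPoint) (v : Place) :
    ∃ σ : F.MaxCone, F.IsIntegralIn P v σ.1 := by
  -- Tropicalization: `-log |χ^m|_v` is linear in `m`, hence is pairing with a vector `x` of `N_ℝ`.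
  -- Integrality means that this form is nonnegative on the characters that do not vanish at `P`.
  let l : (Fin d → ℤ) →+ ℝ :=
    { toFun := fun m => -Real.log (placeAbs v (F.orbitChar P (Multiplicative.ofAdd m) : ℚ))
      map_zero' := by simp
      map_add' := fun m n => by
        rw [ofAdd_add, map_mul, Units.val_mul, map_mul, Real.log_mul, neg_add]
        · exact (placeAbs v).ne_zero (Units.ne_zero _)
        · exact (placeAbs v).ne_zero (Units.ne_zero _) }
  let x : Fin d → ℝ := fun i => l (Pi.single i 1)
  have hl : ∀ m : Fin d → ℤ, l m = (fun i => (m i : ℝ)) ⬝ᵥ x := by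
    intro m
    have hm : m = ∑ i, m i • (Pi.single i 1 : Fin d → ℤ) := by
      ext j
      simp [Pi.single_apply]
    conv_lhs => rw [hm]
    rw [map_sum]
    refine Finset.sum_congr rfl fun i _ => ?_
    rw [map_zsmul, zsmul_eq_mul]
  -- Adding multiples of the interior vector of the orbit cone leaves the pairing with characters
  -- invertible at `P` unchanged, so `x` may be moved into a cone of the star.
  obtain ⟨σ, hσ, hκσ, k, ⟨c, hc, hck⟩, -⟩ := hF.exists_add_mem (F.orbitCone P).2 x
  obtain ⟨σ', hσ'⟩ := hF.exists_maxCone ⟨σ, hσ⟩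
  obtain ⟨z, hz⟩ := F.exists_inChart_orbitCone P
  have hx := F.inChart_of_subset (σ := σ'.1) (hκσ.trans hσ') hz
  refine ⟨σ', _, hx, fun m => ?_⟩
  by_cases h0 : (z.comp (F.restr (hκσ.trans hσ'))) (F.chi m) = 0
  · rw [h0, map_zero]
    exact zero_le_one
  have hm := (hx.apply_chi_ne_zero_iff m).1 h0
  rw [← F.charValue_eq hx, F.charValue_eq_orbitChar hm]
  suffices h : 0 ≤ l m by
    refine (Real.log_nonpos_iff (AbsoluteValue.nonneg _ _)).1 ?_
    change 0 ≤ -Real.log _ at h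
    linarith
  have h1 : (fun i => ((m : Fin d → ℤ) i : ℝ)) ⬝ᵥ F.interiorVector (F.orbitCone P).1 = 0 := by
    rw [dotProduct_interiorVector]
    exact Finset.sum_eq_zero fun ρ hρ => by rw [hm ρ hρ, Int.cast_zero]
  have h2 := congrArg ((fun i => ((m : Fin d → ℤ) i : ℝ)) ⬝ᵥ ·) hck
  simp only [dotProduct_add, dotProduct_smul, h1, smul_zero, add_zero, dotProduct_sum,
    dotProduct_gen] at h2
  rw [hl, h2]
  refine Finset.sum_nonneg fun ρ hρ => mul_nonneg (hc ρ) ?_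
  exact_mod_cast m.2 ρ (hσ' hρ)

lemma IsComplete.isIntegralIn_integralCone (hF : F.IsComplete) (P : F.RatPoint) (σ₀ : F.MaxCone)
    (v : Place) : F.IsIntegralIn P v (F.integralCone P σ₀ v).1 := by
  have h := hF.exists_isIntegralIn P v
  by_cases h1 : F.IsIntegralIn P v σ₀.1
  · rwa [integralCone, if_pos h1]
  · rw [integralCone, if_neg h1, dif_pos h]
    exact h.choose_spec

lemma IsComplete.exists_inChart_maxCone (hF : F.IsComplete) (P : F.RatPoint) :
    ∃ σ : F.MaxCone, ∃ x, F.InChart P σ.1 x := by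
  obtain ⟨σ, x, hx, -⟩ := hF.exists_isIntegralIn P none
  exact ⟨σ, x, hx⟩

end SmoothFan

namespace SmoothFan

variable {d : ℕ} {ι : Type} [Fintype ι] [DecidableEq ι] {F : SmoothFan d ι}

/-! ### Absolute values of integral Cox coordinates -/

/-- For a ray outside the orbit cone, the local equation of `D_ρ` is thus invertible at `P`, and
`orbitChar` gives its value. -/
lemma pair_localEq_single {P : F.RatPoint} {σ : F.MaxCone} (hσ : (F.orbitCone P).1 ⊆ σ.1.1)
    {ρ : ι} (hρ : ρ ∉ (F.orbitCone P).1) :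
    ∀ ρ' ∈ (F.orbitCone P).1, F.pair (F.localEq σ (Pi.single ρ 1)) ρ' = 0 := by
  intro ρ' hρ'
  rw [F.pair_localEq σ _ (hσ hρ'), Pi.single_eq_of_ne]
  rintro rfl
  exact hρ hρ'

/-- Expand `div χ^m = ∑ ⟨m, v_ρ⟩ D_ρ` and apply `localEq`, which recovers `m`. The cone `σ` is
arbitrary, so it may vary with the place. -/
lemma orbitChar_eq_prod (P : F.RatPoint) (σ : F.MaxCone) (m : Fin d → ℤ) :
    F.orbitChar P (Multiplicative.ofAdd m) =
      ∏ ρ, F.orbitChar P (Multiplicative.ofAdd (F.localEq σ (Pi.single ρ 1))) ^ F.pair m ρ := by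
  have h : F.divChar m = ∑ ρ, F.pair m ρ • (Pi.single ρ 1 : F.TDiv) := by
    ext ρ
    simp [Pi.single_apply, divChar]
  conv_lhs => rw [← F.localEq_divChar σ m, h, map_sum, ofAdd_sum, map_prod]
  simp only [map_zsmul, ofAdd_zsmul, map_zpow]

/-- The absolute values `Y_ρ` of integral homogeneous coordinates of a rational point. They vanish
exactly for the rays of the cone of the orbit, and are bounded by the heights for the divisors of
the rays. -/
lemma IsComplete.exists_coordinates (hF : F.IsComplete) (P : F.RatPoint) :
    ∃ Y : ι → ℕ, (∀ ρ, Y ρ = 0 ↔ ρ ∈ (F.orbitCone P).1) ∧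
      (∀ ρ, ρ ∉ (F.orbitCone P).1 → (Y ρ : ℝ) ≤ F.height (Pi.single ρ 1) P) ∧
      ∀ m : Fin d → ℤ, (∀ ρ ∈ (F.orbitCone P).1, F.pair m ρ = 0) →
        |(F.charValue P m : ℝ)| = ∏ ρ, (Y ρ : ℝ) ^ F.pair m ρ := by
  have hex := hF.exists_inChart_maxCone P
  set σ₀ := hex.choose
  let σ : Place → F.MaxCone := F.integralCone P σ₀
  have hσκ : ∀ v, (F.orbitCone P).1 ⊆ (σ v).1.1 := fun v => by
    obtain ⟨x, hx, -⟩ := hF.isIntegralIn_integralCone P σ₀ v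
    exact hx.orbitCone_subset
  have hσ₀κ : (F.orbitCone P).1 ⊆ σ₀.1.1 := by
    obtain ⟨x, hx⟩ := hex.choose_spec
    exact hx.orbitCone_subset
  -- The local equation of `D_ρ` at `P` in the chart integral at `v`; its inverse `v`-adic absolute
  -- value is the local contribution to the coordinate.
  let g : Place → ι → ℚˣ := fun v ρ =>
    F.orbitChar P (Multiplicative.ofAdd (F.localEq (σ v) (Pi.single ρ 1)))
  have hle : ∀ v ρ, ρ ∉ (F.orbitCone P).1 → placeAbs v (g v ρ : ℚ) ≤ 1 := by
    intro v ρ hρ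
    obtain ⟨x, hx, h⟩ := hF.isIntegralIn_integralCone P σ₀ v
    have hm : F.localEq (σ v) (Pi.single ρ 1) ∈ F.semigroup (σ v).1.1 := fun ρ' hρ' => by
      rw [F.pair_localEq (σ v) _ hρ']
      have h1 : (0 : ι → ℤ) ≤ Pi.single ρ 1 := Pi.single_nonneg.2 zero_le_one
      exact h1 ρ'
    have h1 := h ⟨_, hm⟩
    rwa [← F.charValue_eq hx, F.charValue_eq_orbitChar (pair_localEq_single (hσκ v) hρ)] at h1
  -- The discrepancy with the local height factor comes from the local equation on `σ₀`. It is a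
  -- rational number independent of `v`, so the product formula removes it.
  have hinv : ∀ ρ, ρ ∉ (F.orbitCone P).1 → ∃ q : ℚ, q ≠ 0 ∧ ∀ v,
      (placeAbs v (g v ρ : ℚ))⁻¹ =
        (F.genNorm (Pi.single ρ 1) P σ₀ v)⁻¹ * placeAbs v q := by
    intro ρ hρ
    refine ⟨((F.orbitChar P (Multiplicative.ofAdd (F.localEq σ₀ (Pi.single ρ 1))))⁻¹ : ℚˣ),
      Units.ne_zero _, fun v => ?_⟩
    have hm : ∀ ρ' ∈ (F.orbitCone P).1, F.pair (F.localEq (σ v) (Pi.single ρ 1) -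
        F.localEq σ₀ (Pi.single ρ 1)) ρ' = 0 := fun ρ' hρ' => by
      rw [sub_eq_add_neg, pair_add, pair_neg, pair_localEq_single (hσκ v) hρ ρ' hρ',
        pair_localEq_single hσ₀κ hρ ρ' hρ', neg_zero, add_zero]
    rw [genNorm, F.charValue_eq_orbitChar hm, ← map_inv₀, ← map_inv₀, ← map_mul,
      ← Units.val_inv_eq_inv_val, ← Units.val_inv_eq_inv_val, ← Units.val_mul, ofAdd_sub, map_div,
      inv_div, div_mul_comm, inv_div_left, mul_comm _ (F.orbitChar P _), mul_inv_rev,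
      mul_inv_cancel_left]
  have hfin : ∀ ρ, ρ ∉ (F.orbitCone P).1 →
      Function.HasFiniteMulSupport fun v => (placeAbs v (g v ρ : ℚ))⁻¹ := by
    intro ρ hρ
    obtain ⟨q, hq, h⟩ := hinv ρ hρ
    simp only [h]
    exact Function.HasFiniteMulSupport.fun_mul (F.finite_mulSupport hex.choose_spec _)
      (finite_mulSupport_placeAbs hq)
  have hheight : ∀ ρ, ρ ∉ (F.orbitCone P).1 →
      F.height (Pi.single ρ 1) P = ∏ᶠ v, (placeAbs v (g v ρ : ℚ))⁻¹ := by
    intro ρ hρ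
    obtain ⟨q, hq, h⟩ := hinv ρ hρ
    simp only [h]
    rw [finprod_mul_distrib (F.finite_mulSupport hex.choose_spec _)
      (finite_mulSupport_placeAbs hq), finprod_placeAbs hq, mul_one, height, dif_pos hex]
  have hfin' : ∀ ρ, ρ ∉ (F.orbitCone P).1 →
      Function.HasFiniteMulSupport
        fun p : Nat.Primes => (placeAbs (some p) (g (some p) ρ : ℚ))⁻¹ := fun ρ hρ =>
    (hfin ρ hρ).preimage (Option.some_injective _).injOn
  have hnat : ∀ ρ, ∃ n : ℕ, (n = 0 ↔ ρ ∈ (F.orbitCone P).1) ∧ (ρ ∉ (F.orbitCone P).1 →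
      (n : ℝ) = ∏ᶠ p : Nat.Primes, (placeAbs (some p) (g (some p) ρ : ℚ))⁻¹) := by
    intro ρ
    by_cases hρ : ρ ∈ (F.orbitCone P).1
    · exact ⟨0, by simp [hρ], fun h => absurd hρ h⟩
    obtain ⟨n, hn, h⟩ := finprod_induction (f := fun p : Nat.Primes =>
      (placeAbs (some p) (g (some p) ρ : ℚ))⁻¹) (fun r : ℝ => ∃ n : ℕ, 0 < n ∧ r = n)
      ⟨1, one_pos, by simp⟩
      (by
        rintro _ _ ⟨a, ha, rfl⟩ ⟨b, hb, rfl⟩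
        exact ⟨a * b, Nat.mul_pos ha hb, by push_cast; rfl⟩)
      (fun p => placeAbs_prime_inv_mem_natCast (Units.ne_zero _) (hle (some p) ρ hρ))
    exact ⟨n, by simp [hρ, hn.ne'], fun _ => h.symm⟩
  choose Y hY0 hY using hnat
  refine ⟨Y, hY0, fun ρ hρ => ?_, fun m hm => ?_⟩
  · rw [hheight ρ hρ, finprod_option (hfin' ρ hρ), hY ρ hρ]
    -- The height is `Y ρ` times the real factor, which is at least 1 by integrality at the real
    -- place.
    refine le_mul_of_one_le_left (finprod_nonneg fun p => inv_nonneg.2 (AbsoluteValue.nonneg _ _)) ?_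
    exact (one_le_inv₀ ((placeAbs none).pos (Units.ne_zero _))).2 (hle none ρ hρ)
  · rw [F.charValue_eq_orbitChar hm]
    set q : ℚ := ((F.orbitChar P (Multiplicative.ofAdd m) : ℚˣ) : ℚ) with hq
    have hq0 : q ≠ 0 := Units.ne_zero _
    have hv : ∀ v, (placeAbs v q)⁻¹ = ∏ ρ, ((placeAbs v (g v ρ : ℚ))⁻¹) ^ F.pair m ρ := by
      intro v
      rw [hq, orbitChar_eq_prod P (σ v) m, Units.coe_prod, map_prod, ← Finset.prod_inv_distrib]
      refine Finset.prod_congr rfl fun ρ _ => ?_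
      rw [Units.val_zpow_eq_zpow_val, map_zpow₀, inv_zpow]
    -- The product formula expresses the real absolute value through the primes, where `Y` is
    -- defined.
    have hprod := finprod_placeAbs hq0
    rw [finprod_option (f := fun v => placeAbs v q)
      ((finite_mulSupport_placeAbs hq0).preimage (Option.some_injective _).injOn)] at hprod
    have h1 := eq_inv_of_mul_eq_one_left hprod
    rw [← finprod_inv_distrib] at h1
    simp only [hv] at h1
    change placeAbs none q = _
    rw [h1, finprod_prod_comm]
    · refine Finset.prod_congr rfl fun ρ _ => ?_
      by_cases hρ : ρ ∈ (F.orbitCone P).1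
      -- Here `Y ρ = 0`, but the exponent is 0 as well and `0 ^ 0 = 1`.
      · simp [hm ρ hρ]
      · rw [hY ρ hρ]
        exact ((zpowGroupHom (F.pair m ρ) : ℝ →* ℝ).map_finprod (hfin' ρ hρ)).symm
    · intro ρ _
      by_cases hρ : ρ ∈ (F.orbitCone P).1
      · simp [hm ρ hρ, Function.HasFiniteMulSupport]
      · exact (hfin' ρ hρ).fun_comp (one_zpow _)

/-! ### Recovering a point from coordinates and signs -/

/-- The dual basis of the semigroup of a maximal cone. -/
def maxBasis (F : SmoothFan d ι) (σ : F.MaxCone) : Fin d → F.semigroup σ.1.1 :=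
  (F.exists_maxBasis σ).choose

/-- The basis generates `σ^∨ ∩ M` as a monoid, and there is only one ring homomorphism from `ℚ` to
`ℚ` for the scalars. -/
lemma ringHom_ext_maxBasis {σ : F.MaxCone} {x y : F.chartRing σ.1.1 →+* ℚ}
    (h : ∀ i, x (F.chi (F.maxBasis σ i)) = y (F.chi (F.maxBasis σ i))) : x = y := by
  obtain ⟨r, hr, hm⟩ := (F.exists_maxBasis σ).choose_spec
  let c : Multiplicative (F.semigroup σ.1.1) →* F.chartRing σ.1.1 :=
    { toFun := fun m => F.chi m.toAdd
      map_one' := F.chi_zero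
      map_mul' := fun m n => F.chi_add _ _ }
  refine AddMonoidAlgebra.ringHom_ext (fun q => ?_) fun m => ?_
  · exact RingHom.congr_fun (Subsingleton.elim
      (x.comp AddMonoidAlgebra.singleZeroRingHom) (y.comp AddMonoidAlgebra.singleZeroRingHom)) q
  · have hsum : m = ∑ i, (F.pair m (r i)).toNat • F.maxBasis σ i := by
      ext1
      conv_lhs => rw [hm m]
      rw [AddSubmonoid.coe_finsetSum]
      refine Finset.sum_congr rfl fun i _ => ?_
      rw [AddSubmonoidClass.coe_nsmul, ← natCast_zsmul, Int.toNat_of_nonneg (m.2 _ (hr i))]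
      rfl
    change x (c (Multiplicative.ofAdd m)) = y (c (Multiplicative.ofAdd m))
    rw [hsum, ofAdd_sum, map_prod, map_prod, map_prod]
    refine Finset.prod_congr rfl fun i _ => ?_
    rw [ofAdd_nsmul, map_pow, map_pow, map_pow]
    exact congrArg (· ^ _) (h i)

/-- A rational point is determined by the absolute values of its coordinates and the signs of a
basis of characters of a maximal chart. -/
lemma eq_of_coordinates {P P' : F.RatPoint} {σ : F.MaxCone} (hP : ∃ x, F.InChart P σ.1 x)
    (hP' : ∃ x, F.InChart P' σ.1 x) {Y : ι → ℕ}
    (hY : ∀ m : Fin d → ℤ, (∀ ρ ∈ (F.orbitCone P).1, F.pair m ρ = 0) →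
        |(F.charValue P m : ℝ)| = ∏ ρ, (Y ρ : ℝ) ^ F.pair m ρ)
    (hY' : ∀ m : Fin d → ℤ, (∀ ρ ∈ (F.orbitCone P').1, F.pair m ρ = 0) →
        |(F.charValue P' m : ℝ)| = ∏ ρ, (Y ρ : ℝ) ^ F.pair m ρ)
    (hsign : ∀ i, SignType.sign (F.charValue P (F.maxBasis σ i)) =
      SignType.sign (F.charValue P' (F.maxBasis σ i))) : P = P' := by
  obtain ⟨x, hx⟩ := hP
  obtain ⟨x', hx'⟩ := hP'
  suffices x = x' by rw [← hx, ← hx', this]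
  refine ringHom_ext_maxBasis fun i => ?_
  have hs := hsign i
  rw [F.charValue_eq hx, F.charValue_eq hx'] at hs
  by_cases h0 : x (F.chi (F.maxBasis σ i)) = 0
  · rw [h0, sign_zero] at hs
    rw [h0, sign_eq_zero_iff.1 hs.symm]
  have h0' : x' (F.chi (F.maxBasis σ i)) ≠ 0 := fun h => by
    rw [h, sign_zero] at hs
    exact h0 (sign_eq_zero_iff.1 hs)
  have h1 := hY _ ((hx.apply_chi_ne_zero_iff _).1 h0)
  rw [← hY' _ ((hx'.apply_chi_ne_zero_iff _).1 h0'), F.charValue_eq hx, F.charValue_eq hx',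
    ← Rat.cast_abs, ← Rat.cast_abs, Rat.cast_inj] at h1
  rw [← sign_mul_abs (x _), ← sign_mul_abs (x' _), hs, h1]

/-! ### Counting -/

lemma isCompact_of_isFiniteUnion {K : Set F.DualPic}
    (hK : F.IsFiniteUnionOfCompactPolyhedra K) : IsCompact K := by
  obtain ⟨k, Q, hQ, rfl⟩ := hK
  exact isCompact_iUnion fun i => (hQ i).1

lemma continuous_eval (L : F.Pic) : Continuous fun a : F.DualPic => a L :=
  (continuous_apply L).comp continuous_induced_dom

/-- Compact sets of linear forms are bounded on the classes of the rays. -/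
lemma exists_bound_rayClass {K : Set F.DualPic} (hK : IsCompact K) :
    ∃ c : ℝ, ∀ a ∈ K, ∀ ρ, a (F.rayClass ρ) ≤ c := by
  have h : ∀ ρ, ∃ c : ℝ, ∀ a ∈ K, a (F.rayClass ρ) ≤ c := fun ρ => by
    obtain ⟨c, hc⟩ := (hK.image (continuous_eval (F.rayClass ρ))).bddAbove
    exact ⟨c, fun a ha => hc ⟨a, ha, rfl⟩⟩
  choose c hc using h
  exact ⟨∑ ρ, |c ρ|, fun a ha ρ => ((hc ρ a ha).trans (le_abs_self _)).trans
    (Finset.single_le_sum (f := fun ρ => |c ρ|) (fun _ _ => abs_nonneg _) (Finset.mem_univ ρ))⟩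

lemma isEffective_rayClass (ρ : ι) : F.IsEffective (F.rayClass ρ) :=
  ⟨Pi.single ρ 1, Pi.single_nonneg.2 zero_le_one, rfl⟩

/-- Evaluate the multi-height at `[D_ρ]` and exponentiate; `hpos` is needed because `Real.log` does
not see signs. -/
lemma height_le_of_mem_translate {D₁ : Set F.DualPic} {u : F.DualPic} {B c : ℝ} (hB : 1 ≤ B)
    {ρ : ι} (hc : ∀ a ∈ D₁, a (F.rayClass ρ) ≤ c) {P : F.RatPoint}
    (hP : F.multiHeight P ∈ F.translate D₁ u B) (hpos : 0 < F.height (Pi.single ρ 1) P) :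
    F.height (Pi.single ρ 1) P ≤ Real.exp c * B ^ u (F.rayClass ρ) := by
  obtain ⟨b, hb, h⟩ := hP
  have h1 : Real.log (F.height (Pi.single ρ 1) P) =
      b (F.rayClass ρ) + Real.log B * u (F.rayClass ρ) :=
    congrArg (fun a : F.DualPic => a (F.rayClass ρ)) h
  rw [Real.rpow_def_of_pos (by linarith), ← Real.exp_add, ← Real.log_le_iff_le_exp hpos, h1]
  linarith [hc b hb]

/-! ### Counting tuples with a zero entry -/

/-- The tuples of natural numbers bounded by `N`, one of which vanishes. -/
def boundedTuples (N : ι → ℕ) : Finset (ι → ℕ) :=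
  Finset.univ.biUnion fun ρ₀ : ι =>
    Fintype.piFinset fun ρ => if ρ = ρ₀ then {0} else Finset.range (N ρ + 1)

lemma mem_boundedTuples {N Y : ι → ℕ} {ρ₀ : ι} (h0 : Y ρ₀ = 0) (h : ∀ ρ, Y ρ ≤ N ρ) :
    Y ∈ boundedTuples N := by
  simp only [boundedTuples, Finset.mem_biUnion, Fintype.mem_piFinset]
  refine ⟨ρ₀, Finset.mem_univ _, fun ρ => ?_⟩
  split_ifs with hρ
  · simp [hρ, h0]
  · simpa [Nat.lt_succ_iff] using h ρ

/-- Fixing the entry at `ρ₀` to be zero saves the factor `B ^ w ρ₀`, at least `B` to the infimum;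
summing over `ρ₀` gives the factor `Fintype.card ι`. -/
lemma card_boundedTuples_le {A B : ℝ} (hA : 1 ≤ A) (hB : 1 ≤ B) {w : ι → ℝ} {N : ι → ℕ}
    (hN : ∀ ρ, (N ρ : ℝ) + 1 ≤ A * B ^ w ρ) :
    ((boundedTuples N).card : ℝ) ≤
      Fintype.card ι * A ^ Fintype.card ι * (B ^ (∑ ρ, w ρ) / B ^ (⨅ ρ, w ρ)) := by
  have hB0 : 0 < B := by linarith
  have key : ∀ ρ₀ : ι, ((Fintype.piFinset fun ρ =>
      if ρ = ρ₀ then {0} else Finset.range (N ρ + 1)).card : ℝ) ≤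
      A ^ Fintype.card ι * (B ^ (∑ ρ, w ρ) / B ^ (⨅ ρ, w ρ)) := by
    intro ρ₀
    rw [mul_div_assoc', le_div_iff₀ (by positivity)]
    have hmin : B ^ (⨅ ρ, w ρ) ≤ B ^ w ρ₀ :=
      Real.rpow_le_rpow_of_exponent_le hB (ciInf_le (Set.finite_range w).bddBelow ρ₀)
    refine (mul_le_mul_of_nonneg_left hmin (Nat.cast_nonneg _)).trans ?_
    rw [Real.rpow_sum_of_pos hB0, ← Finset.card_univ, ← Finset.prod_const, ← Finset.prod_mul_distrib,
      Fintype.card_piFinset, Nat.cast_prod]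
    -- Spreading the saved factor over the product permits a comparison entry by entry.
    have hsingle : B ^ w ρ₀ = ∏ ρ, if ρ = ρ₀ then B ^ w ρ₀ else 1 := by simp
    rw [hsingle, ← Finset.prod_mul_distrib]
    refine Finset.prod_le_prod (fun ρ _ => ?_) fun ρ _ => ?_
    · exact mul_nonneg (Nat.cast_nonneg _) (by split_ifs <;> positivity)
    · split_ifs with hρ
      · rw [hρ, Finset.card_singleton, Nat.cast_one]
        exact mul_le_mul_of_nonneg_right hA (by positivity)
      · simpa using hN ρ
  calc ((boundedTuples N).card : ℝ)
      ≤ ∑ ρ₀ : ι, ((Fintype.piFinset fun ρ =>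
          if ρ = ρ₀ then {0} else Finset.range (N ρ + 1)).card : ℝ) := by
        exact_mod_cast Finset.card_biUnion_le
    _ ≤ ∑ _ρ₀ : ι, A ^ Fintype.card ι * (B ^ (∑ ρ, w ρ) / B ^ (⨅ ρ, w ρ)) :=
        Finset.sum_le_sum fun ρ₀ _ => key ρ₀
    _ = _ := by rw [Finset.sum_const, Finset.card_univ, nsmul_eq_mul, mul_assoc]

end SmoothFan

/-! ### The upper bound for boundary points -/

open SmoothFan in
theorem mainTheorem5 {d : ℕ} {ι : Type} [Fintype ι] [DecidableEq ι] (F : SmoothFan d ι)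
    (hF : F.IsComplete) (D₁ : Set F.DualPic) (hD₁ : F.IsFiniteUnionOfCompactPolyhedra D₁)
    (u : F.DualPic) (hu : u ∈ interior F.dualEffCone) :
    ∃ C : ℝ, 0 < C ∧ ∀ B : ℝ, 1 ≤ B →
      (F.boundaryPoints (F.translate D₁ u B)).Finite ∧
      ((F.boundaryPoints (F.translate D₁ u B)).ncard : ℝ) ≤
        C * (B ^ u F.anticanonical / B ^ (⨅ ρ : ι, u (F.rayClass ρ))) := by
  have := Fintype.ofFinite F.MaxCone
  obtain ⟨c, hc⟩ := exists_bound_rayClass (isCompact_of_isFiniteUnion hD₁)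
  have hw : ∀ ρ, 0 ≤ u (F.rayClass ρ) := fun ρ => interior_subset hu _ (isEffective_rayClass ρ)
  choose Y hY0 hYle hY using hF.exists_coordinates
  choose σ hσ using hF.exists_inChart_maxCone
  -- The encoding by a maximal chart, signs and coordinates; its first component has finitely many
  -- values, independently of `B`.
  let Φ : F.RatPoint → (F.MaxCone × (Fin d → SignType)) × (ι → ℕ) := fun P =>
    ((σ P, fun i => SignType.sign (F.charValue P (F.maxBasis (σ P) i))), Y P)
  have hΦ : Function.Injective Φ := by
    intro P P' h
    simp only [Φ, Prod.mk.injEq] at h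
    obtain ⟨⟨h1, h2⟩, h3⟩ := h
    have hσ' := hσ P'
    have hY' := hY P'
    rw [← h1] at hσ' h2
    rw [← h3] at hY'
    exact eq_of_coordinates (hσ P) hσ' (hY P) hY' (congrFun h2)
  -- The summand 1 absorbs the value zero in the count `N ρ + 1`, as `B ^ u (F.rayClass ρ) ≥ 1`
  -- because ray classes are effective.
  set A : ℝ := Real.exp c + 1 with hA
  have hA1 : 1 ≤ A := by linarith [Real.exp_pos c]
  set k : ℝ := (Fintype.card (F.MaxCone × (Fin d → SignType)) : ℝ)
  -- The final `+ 1` keeps the constant positive even if `ι` is empty.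
  refine ⟨k * (Fintype.card ι * A ^ Fintype.card ι) + 1, by positivity, fun B hB => ?_⟩
  have hB0 : 0 < B := by linarith
  let N : ι → ℕ := fun ρ => ⌊Real.exp c * B ^ u (F.rayClass ρ)⌋₊
  let T : Finset ((F.MaxCone × (Fin d → SignType)) × (ι → ℕ)) := Finset.univ ×ˢ boundedTuples N
  have hmaps : ∀ P ∈ F.boundaryPoints (F.translate D₁ u B), Φ P ∈ (T : Set _) := by
    rintro P ⟨hP, hPB⟩
    -- Being off the torus is used here: it supplies the zero coordinate.
    obtain ⟨ρ₀, hρ₀⟩ := F.orbitCone_nonempty hP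
    refine Finset.mem_coe.2 (Finset.mem_product.2 ⟨Finset.mem_univ _,
      mem_boundedTuples ((hY0 P ρ₀).2 hρ₀) fun ρ => ?_⟩)
    by_cases hρ : ρ ∈ (F.orbitCone P).1
    · change Y P ρ ≤ _
      rw [(hY0 P ρ).2 hρ]
      exact Nat.zero_le _
    · refine Nat.le_floor ((hYle P ρ hρ).trans
        (height_le_of_mem_translate hB (fun a ha => hc a ha ρ) hPB ?_))
      refine lt_of_lt_of_le ?_ (hYle P ρ hρ)
      exact_mod_cast Nat.pos_of_ne_zero fun h => hρ ((hY0 P ρ).1 h)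
  have hfin : (F.boundaryPoints (F.translate D₁ u B)).Finite :=
    Set.Finite.of_finite_image (T.finite_toSet.subset (Set.image_subset_iff.2 hmaps)) hΦ.injOn
  refine ⟨hfin, ?_⟩
  have hcard : (F.boundaryPoints (F.translate D₁ u B)).ncard ≤ T.card := by
    rw [← Set.ncard_coe_finset T]
    exact Set.ncard_le_ncard_of_injOn Φ hmaps hΦ.injOn T.finite_toSet
  have hN : ∀ ρ, (N ρ : ℝ) + 1 ≤ A * B ^ u (F.rayClass ρ) := fun ρ => by
    have h1 : (N ρ : ℝ) ≤ Real.exp c * B ^ u (F.rayClass ρ) := Nat.floor_le (by positivity)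
    have h2 : 1 ≤ B ^ u (F.rayClass ρ) := Real.one_le_rpow hB (hw ρ)
    rw [hA, add_mul, one_mul]
    linarith
  have hbound := card_boundedTuples_le hA1 hB hN
  rw [← map_sum] at hbound
  calc ((F.boundaryPoints (F.translate D₁ u B)).ncard : ℝ)
      ≤ T.card := by exact_mod_cast hcard
    _ = k * (boundedTuples N).card := by
        rw [Finset.card_product, Finset.card_univ, Nat.cast_mul]
    _ ≤ k * (Fintype.card ι * A ^ Fintype.card ι * (B ^ u F.anticanonical /
          B ^ (⨅ ρ : ι, u (F.rayClass ρ)))) :=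
        mul_le_mul_of_nonneg_left hbound (Nat.cast_nonneg _)
    _ ≤ _ := by
        rw [← mul_assoc]
        exact mul_le_mul_of_nonneg_right (by linarith) (by positivity)

end
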